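/- Let $k\ge 1$ be an integer. There is an $m=m(k)$ such that the following holds for all $b,c,f\in C^m[0,1]$ and all constants $\beta>1$, $\gamma>0$, $\sigma\ge k+1$ with $b\ge\beta$ and $c+\tfrac12 b'\ge\gamma$ on $[0,1]$. For $\varepsilon>0$ let $u\in C[0,1]\cap C^2(0,1)$ be the solution of $$-\varepsilon u''-b u'+c u=f\ \text{ in }(0,1),\qquad u(0)=u(1)=0 .$$ Let $N$ be a positive even integer with $\varepsilon\le N^{-1}$, and let the mesh points be $x_i=\psi(i/N)$ or $x_i=\varphi(i/N)$, $i=0,\dots,N$, where either (Roos) $\psi(t)=-\sigma\varepsilon\ln(1-2(1-\varepsilon)t)$ for $t\in[0,1/2]$ and $\psi(t)=1-d(1-t)$ for $t\in(1/2,1]$, with $d$ determined by continuity at $t=1/2$; or (Kopteva) $\varphi(t)=-\sigma\varepsilon\ln(1-2t)$ for $t\in[0,\vartheta]$ and $\varphi(t)=1-d_1(1-t)$ for $t\in(\vartheta,1]$, with $\vartheta=1/2-C_1\varepsilon$, where $C_1>0$ is a constant independent of $\varepsilon$ and $N$ with $C_1\le 1/(\varepsilon N)$, and $d_1$ is determined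 by continuity at $t=\vartheta$. Assume $d>0$ (respectively $d_1>0$), so that $0=x_0<x_1<\dots<x_N=1$. Let $V^N$ be the space of all $w\in C[0,1]$ with $w(0)=w(1)=0$ whose restriction to each $[x_i,x_{i+1}]$, $0\le i<N$, is a polynomial of degree at most $k$, and let $u^N\in V^N$ be the Galerkin solution: $$\varepsilon\int_0^1 (u^N)'v'\,dx-\int_0^1 b\,(u^N)'v\,dx+\int_0^1 c\,u^N v\,dx=\int_0^1 f v\,dx\qquad\text{for all } v\in V^N .$$ Then $u-u^N\in H^1(0,1)$ and $$\|u-u^N\|_\varepsilon:=\Big(\varepsilon\int_0^1 |(u-u^N)'|^2dx+\int_0^1|u-u^N|^2dx\Big)^{1/2}\le C N^{-k},$$ where $C$ is independent of $\varepsilon$ and $N$ (it may depend on $k,b,c,f,\beta,\gamma,\sigma$ and, for Kopteva's mesh, on $C_1$). -/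

import Mathlib

open Set MeasureTheory

noncomputable section

namespace BakhvalovFEM

/-- `u` is a classical solution of `-ε u'' - b u' + c u = f` on `(0,1)`, `u(0) = u(1) = 0`. -/
structure IsSolution (ε : ℝ) (b c f u : ℝ → ℝ) : Prop where
  continuousOn : ContinuousOn u (Icc 0 1)
  contDiffOn : ContDiffOn ℝ 2 u (Ioo 0 1)
  equation : ∀ x ∈ Ioo (0 : ℝ) 1,
    -ε * deriv (deriv u) x - b x * deriv u x + c x * u x = f x
  left_zero : u 0 = 0
  right_zero : u 1 = 0

/-- The slope `d` for which `t ↦ 1 - d (1 - t)` takes the value `y` at `t = τ`. -/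
def coarseSlope (τ y : ℝ) : ℝ := (1 - y) / (1 - τ)

/-- The layer branch of Roos' mesh generating function. -/
def roosFine (σ ε t : ℝ) : ℝ := -σ * ε * Real.log (1 - 2 * (1 - ε) * t)

/-- The slope `d` of the coarse branch of Roos' mesh generating function (continuity at `1/2`). -/
def roosSlope (σ ε : ℝ) : ℝ := coarseSlope (1 / 2) (roosFine σ ε (1 / 2))

/-- Roos' mesh generating function `ψ`. -/
def roosMap (σ ε t : ℝ) : ℝ :=
  if t ≤ 1 / 2 then roosFine σ ε t else 1 - roosSlope σ ε * (1 - t)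

/-- The layer branch of Kopteva's mesh generating function. -/
def koptevaFine (σ ε t : ℝ) : ℝ := -σ * ε * Real.log (1 - 2 * t)

/-- The breakpoint `ϑ = 1/2 - C₁ ε` of Kopteva's mesh generating function. -/
def koptevaBreak (C₁ ε : ℝ) : ℝ := 1 / 2 - C₁ * ε

/-- The slope `d₁` of the coarse branch of Kopteva's mesh generating function
(continuity at the breakpoint). -/
def koptevaSlope (σ C₁ ε : ℝ) : ℝ :=
  coarseSlope (koptevaBreak C₁ ε) (koptevaFine σ ε (koptevaBreak C₁ ε))

/-- Kopteva's mesh generating function `φ`. -/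
def koptevaMap (σ C₁ ε t : ℝ) : ℝ :=
  if t ≤ koptevaBreak C₁ ε then koptevaFine σ ε t else 1 - koptevaSlope σ C₁ ε * (1 - t)

/-- The mesh points `x_i = ψ(i/N)` generated by `ψ`. -/
def meshPoint (ψ : ℝ → ℝ) (N i : ℕ) : ℝ := ψ ((i : ℝ) / (N : ℝ))

/-- The `C⁰` finite element space: continuous on `[0,1]`, zero at both end points, a polynomial of
degree at most `k` on each mesh interval `[x_i, x_{i+1}]`, `0 ≤ i < N`. -/
def femSpace (k N : ℕ) (x : ℕ → ℝ) : Set (ℝ → ℝ) :=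
  {w | ContinuousOn w (Icc 0 1) ∧ w 0 = 0 ∧ w 1 = 0 ∧
    ∀ i < N, ∃ p : Polynomial ℝ, p.natDegree ≤ k ∧
      ∀ t ∈ Icc (x i) (x (i + 1)), w t = p.eval t}

/-- The bilinear form `a(u,v) = ε (u', v') - (b u', v) + (c u, v)`. It is used for continuous,
piecewise smooth functions, whose weak derivative is the classical one off a finite set. -/
def bilin (ε : ℝ) (b c u v : ℝ → ℝ) : ℝ :=
  ε * (∫ x in (0 : ℝ)..1, deriv u x * deriv v x)
    - (∫ x in (0 : ℝ)..1, b x * deriv u x * v x)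
    + (∫ x in (0 : ℝ)..1, c x * u x * v x)

/-- `w` is the Galerkin solution in the finite element space on the mesh `x`. -/
def IsGalerkinSolution (ε : ℝ) (b c f : ℝ → ℝ) (k N : ℕ) (x : ℕ → ℝ) (w : ℝ → ℝ) : Prop :=
  w ∈ femSpace k N x ∧
    ∀ v ∈ femSpace k N x, bilin ε b c w v = ∫ t in (0 : ℝ)..1, f t * v t

/-- `v` and `v'` are square integrable on `(0,1)`. -/
def FiniteEnergy (v : ℝ → ℝ) : Prop :=
  MemLp v 2 (volume.restrict (Ioo 0 1)) ∧ MemLp (deriv v) 2 (volume.restrict (Ioo 0 1))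

/-- The energy norm `(ε |v|₁² + ‖v‖²)^{1/2}` on `(0,1)`. -/
def energyNorm (ε : ℝ) (v : ℝ → ℝ) : ℝ :=
  Real.sqrt (ε * (∫ x in (0 : ℝ)..1, deriv v x ^ 2) + ∫ x in (0 : ℝ)..1, v x ^ 2)

end BakhvalovFEM

end

noncomputable section

namespace BakhvalovFEM

/-! ### Primitives, extensions and the regularity of solutions -/

/-! The solution is split as `u = S + r`. Here `S` is the outer expansion in powers of `ε`,
truncated so that it solves the equation up to `ε^(k+1) g`, with derivatives up to order `k+1`
bounded uniformly in `ε` (`exists_smooth_part`). The remainder `r` carries the layer at `0`. A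
barrier argument and repeated differentiation of the equation give `ε^i |r^(i)| ≤ C (e^{-β' x/ε} +
ε^(k+1))` with some `1 < β' < β` (`exists_layer_derivative_bound`).

Write `N = 2(n+1)`, so that `x n` lies one interval before index `N/2`. On the graded part the local
width satisfies `(h/ε)^k ≤ C N^{-k} e^{x/ε}`, which is compensated by the decay of `r`. Past `x n`
the factor `e^{-x/ε}` is itself `O(N^{-k})`. Since `β' = 1 + δ` exceeds `1`, a factor `e^{-δ x/ε}`
is left over in both regions. Interpolating `r` on the wide intervals is avoided: its approximant
takes the nodal values of `r` before `x n` and vanishes from `x n` on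
(`IsBakhvalovMesh.exists_layer_approximation`). `S` is interpolated at all nodes.

The error is then `e = A + R + χ`, with `A` and `R` the approximation errors of `S` and `r` and `χ`
in the discrete space, so `a(e, χ) = 0`. The term `(b R', χ)` is integrated by parts, which leaves
`ε^{-1/2} ‖R‖` to be bounded. This is harmless because `R` is `O(N^{-k})` times `e^{-δ x/ε} + ε`,
whose `L²` norm is `O(ε^{1/2})` (`exists_energyNorm_le`).

The layer bounds need `ε ≤ ε₀` and the construction needs `n ≥ 1`. Otherwise `N` is bounded, because
`ε ≤ 1/N`, and energy stability suffices (`exists_energyNorm_sub_le`). Both meshes enter only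
through `IsBakhvalovMesh`. -/

lemma hasDerivAt_primitive {g : ℝ → ℝ} (hg : Continuous g) (a x : ℝ) :
    HasDerivAt (fun x => ∫ t in a..x, g t) (g x) x :=
  intervalIntegral.integral_hasDerivAt_right (hg.intervalIntegrable _ _)
    (hg.stronglyMeasurableAtFilter _ _) hg.continuousAt

lemma contDiff_succ_of_hasDerivAt {n : ℕ} {g G : ℝ → ℝ} (hg : ContDiff ℝ n g)
    (h : ∀ x, HasDerivAt G (g x) x) : ContDiff ℝ (n + 1 : ℕ) G := by
  have h2 : deriv G = g := funext fun x => (h x).deriv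
  push_cast
  rw [contDiff_succ_iff_deriv]
  refine ⟨fun x => (h x).differentiableAt, by simp, ?_⟩
  rwa [h2]

lemma contDiff_primitive {n : ℕ} {g : ℝ → ℝ} (hg : ContDiff ℝ n g) (a : ℝ) :
    ContDiff ℝ (n + 1 : ℕ) (fun x => ∫ t in a..x, g t) :=
  contDiff_succ_of_hasDerivAt hg (hasDerivAt_primitive hg.continuous a)

lemma contDiff_deriv {n : ℕ} {g : ℝ → ℝ} (hg : ContDiff ℝ (n + 1 : ℕ) g) :
    ContDiff ℝ n (deriv g) := by
  push_cast at hg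
  exact (contDiff_succ_iff_deriv.1 hg).2.2

lemma contDiff_of_le {m n : ℕ} {g : ℝ → ℝ} (hg : ContDiff ℝ m g) (h : n ≤ m) :
    ContDiff ℝ n g := hg.of_le (by exact_mod_cast h)

/-- Induction on the order: extend the derivative, then integrate it from `0`. Working with
functions on the whole line afterwards avoids one-sided derivatives. -/
lemma exists_contDiff_extension (n : ℕ) : ∀ g : ℝ → ℝ, ContDiffOn ℝ n g (Icc 0 1) →
    ∃ G : ℝ → ℝ, ContDiff ℝ n G ∧ EqOn G g (Icc 0 1) := by
  induction n with
  | zero =>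
    intro g hg
    have hg' : ContinuousOn g (Icc 0 1) := hg.continuousOn
    refine ⟨IccExtend zero_le_one ((Icc (0 : ℝ) 1).domRestrict g), ?_, ?_⟩
    · have : Continuous (IccExtend (zero_le_one' ℝ) ((Icc (0 : ℝ) 1).domRestrict g)) :=
        (continuousOn_iff_continuous_domRestrict.1 hg').Icc_extend'
      exact contDiff_zero.2 this
    · intro x hx
      rw [IccExtend_of_mem _ _ hx]
      rfl
  | succ n ih =>
    intro g hg
    push_cast at hg
    have hd := (contDiffOn_succ_iff_derivWithin (uniqueDiffOn_Icc zero_lt_one)).1 hg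
    obtain ⟨G, hG, hGg⟩ := ih _ hd.2.2
    refine ⟨fun x => g 0 + ∫ t in (0 : ℝ)..x, G t, contDiff_const.add (contDiff_primitive hG 0), ?_⟩
    intro x hx
    have : ∫ t in (0 : ℝ)..x, G t = g x - g 0 := by
      refine intervalIntegral.integral_eq_sub_of_hasDerivAt_of_le hx.1
        (hd.1.continuousOn.mono (Icc_subset_Icc_right hx.2)) ?_ (hG.continuous.intervalIntegrable _ _)
      intro t ht
      have ht' : t ∈ Ioo (0 : ℝ) 1 := ⟨ht.1, ht.2.trans_le hx.2⟩
      rw [hGg (Ioo_subset_Icc_self ht')]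
      exact ((hd.1 t (Ioo_subset_Icc_self ht')).hasDerivWithinAt).hasDerivAt
        (Icc_mem_nhds ht'.1 ht'.2)
    simp only [this]
    ring

/-- A continuous function on `[0,1]` whose derivative inside is `K + ∫ (a u + h) + e u`
inherits the smoothness of the coefficients. -/
lemma exists_contDiff_of_integral_equation {u a e h : ℝ → ℝ} {K : ℝ} (m : ℕ)
    (hu : ContinuousOn u (Icc 0 1))
    (hd : ∀ x ∈ Ioo (0 : ℝ) 1,
      HasDerivAt u (K + (∫ t in (0 : ℝ)..x, (a t * u t + h t)) + e x * u x) x)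
    (ha : ContDiff ℝ m a) (he : ContDiff ℝ m e) (hh : ContDiff ℝ m h) :
    ∃ U : ℝ → ℝ, ContDiff ℝ (m + 1 : ℕ) U ∧ EqOn U u (Icc 0 1) := by
  -- Bootstrap: if `u` agrees with a `C^n` function, the formula for its derivative is `C^n`, and
  -- the primitive of that formula is a `C^(n+1)` function agreeing with `u`.
  have key : ∀ n : ℕ, n ≤ m + 1 → ∃ U : ℝ → ℝ, ContDiff ℝ n U ∧ EqOn U u (Icc 0 1) := by
    intro n
    induction n with
    | zero =>
      intro _
      exact exists_contDiff_extension 0 u (contDiffOn_zero.2 hu)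
    | succ n ih =>
      intro hn
      obtain ⟨U, hU, hUu⟩ := ih (by omega)
      have ha' := contDiff_of_le ha (show n ≤ m by omega)
      have he' := contDiff_of_le he (show n ≤ m by omega)
      have hh' := contDiff_of_le hh (show n ≤ m by omega)
      have h1 := contDiff_of_le (contDiff_primitive ((ha'.mul hU).add hh') 0) (Nat.le_succ n)
      set V : ℝ → ℝ := fun x => K + (∫ t in (0 : ℝ)..x, (a t * U t + h t)) + e x * U x with hV
      have hVc : ContDiff ℝ n V := (contDiff_const.add h1).add (he'.mul hU)
      refine ⟨fun x => u 0 + ∫ t in (0 : ℝ)..x, V t,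
        contDiff_const.add (contDiff_primitive hVc 0), ?_⟩
      intro x hx
      have : ∫ t in (0 : ℝ)..x, V t = u x - u 0 := by
        refine intervalIntegral.integral_eq_sub_of_hasDerivAt_of_le hx.1
          (hu.mono (Icc_subset_Icc_right hx.2)) ?_ (hVc.continuous.intervalIntegrable _ _)
        intro t ht
        have ht' : t ∈ Ioo (0 : ℝ) 1 := ⟨ht.1, ht.2.trans_le hx.2⟩
        have h2 := hd t ht'
        have h3 : ∫ s in (0 : ℝ)..t, (a s * u s + h s) = ∫ s in (0 : ℝ)..t, (a s * U s + h s) := by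
          refine intervalIntegral.integral_congr fun s hs => ?_
          rw [uIcc_of_le ht.1.le] at hs
          simp only [hUu ⟨hs.1, hs.2.trans ht'.2.le⟩]
        rw [h3, ← hUu (Ioo_subset_Icc_self ht')] at h2
        exact h2
      simp only [this]
      ring
  exact key (m + 1) le_rfl

/-- Classical solutions for smooth data extend to smooth functions on the line. -/
lemma IsSolution.exists_contDiff {ε : ℝ} {b c f u : ℝ → ℝ} {m : ℕ} (hε : 0 < ε)
    (hu : IsSolution ε b c f u) (hb : ContDiff ℝ (m + 1 : ℕ) b) (hc : ContDiff ℝ m c)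
    (hf : ContDiff ℝ m f) :
    ∃ U : ℝ → ℝ, ContDiff ℝ (m + 1 : ℕ) U ∧ EqOn U u (Icc 0 1) := by
  have hbd := contDiff_deriv hb
  have hb0 := contDiff_of_le hb (Nat.le_succ m)
  have hdb : ∀ x, HasDerivAt b (deriv b x) x := fun x =>
    (hb.differentiable (by simp) x).hasDerivAt
  have hdu : ∀ x ∈ Ioo (0 : ℝ) 1, HasDerivAt u (deriv u x) x := fun x hx =>
    ((hu.contDiffOn.differentiableOn (by simp) x hx).differentiableAt
      (Ioo_mem_nhds hx.1 hx.2)).hasDerivAt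
  have hddu : ∀ x ∈ Ioo (0 : ℝ) 1, HasDerivAt (deriv u) (deriv (deriv u) x) x := fun x hx => by
    have h1 : ContDiffOn ℝ 1 (deriv u) (Ioo 0 1) :=
      hu.contDiffOn.deriv_of_isOpen isOpen_Ioo (by norm_num)
    exact ((h1.differentiableOn (by simp) x hx).differentiableAt
      (Ioo_mem_nhds hx.1 hx.2)).hasDerivAt
  have hcu : ContinuousOn (fun x => (deriv b x + c x) * u x - f x) (Icc 0 1) :=
    (((hbd.continuous.add hc.continuous).continuousOn).mul hu.continuousOn).sub
      hf.continuous.continuousOn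
  -- Divergence form: the derivative of the flux involves only `u` and the data, so it is continuous
  -- up to the end points, where nothing is known about `u'` yet.
  set F : ℝ → ℝ := fun x => ε * deriv u x + b x * u x with hF
  have hFd : ∀ x ∈ Ioo (0 : ℝ) 1, HasDerivAt F ((deriv b x + c x) * u x - f x) x := by
    intro x hx
    have h1 := ((hddu x hx).const_mul ε).add ((hdb x).mul (hdu x hx))
    refine h1.congr_deriv ?_
    linear_combination -(hu.equation x hx)
  set h : ℝ := F (1 / 2) - ∫ t in (0 : ℝ)..(1 / 2), ((deriv b t + c t) * u t - f t) with hh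
  have hFe : ∀ x ∈ Ioo (0 : ℝ) 1, F x = h + ∫ t in (0 : ℝ)..x, ((deriv b t + c t) * u t - f t) := by
    intro x hx
    have hsub : uIcc (1 / 2) x ⊆ Ioo (0 : ℝ) 1 :=
      (convex_Ioo (0 : ℝ) 1).ordConnected.uIcc_subset (by norm_num) hx
    have hi : ∀ y ∈ Ioo (0 : ℝ) 1, ∀ z ∈ Icc (0 : ℝ) 1, IntervalIntegrable
        (fun t => (deriv b t + c t) * u t - f t) volume z y := fun y hy z hz =>
      (hcu.mono ((convex_Icc (0 : ℝ) 1).ordConnected.uIcc_subset hz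
        (Ioo_subset_Icc_self hy))).intervalIntegrable
    have h1 : ∫ t in (1 / 2)..x, ((deriv b t + c t) * u t - f t) = F x - F (1 / 2) :=
      intervalIntegral.integral_eq_sub_of_hasDerivAt (fun t ht => hFd t (hsub ht))
        (hi x hx _ (by norm_num))
    have h2 := intervalIntegral.integral_add_adjacent_intervals
      (hi (1 / 2) (by norm_num) 0 (by norm_num)) (hi x hx (1 / 2) (by norm_num))
    rw [← h2, h1, hh]
    ring
  refine exists_contDiff_of_integral_equation (a := fun x => (deriv b x + c x) / ε)
    (e := fun x => -b x / ε) (h := fun x => -f x / ε) (K := h / ε) m hu.continuousOn ?_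
    ((hbd.add hc).div_const ε) (hb0.neg.div_const ε) (hf.neg.div_const ε)
  intro x hx
  refine (hdu x hx).congr_deriv ?_
  have h1 : ∫ t in (0 : ℝ)..x, ((deriv b t + c t) / ε * u t + -f t / ε)
      = (∫ t in (0 : ℝ)..x, ((deriv b t + c t) * u t - f t)) / ε := by
    rw [← intervalIntegral.integral_div]
    congr 1
    ext t
    ring
  have h2 := hFe x hx
  rw [h1]
  field_simp
  simp only [hF] at h2
  linarith

/-! ### The smooth part of the solution -/

/-- Variation of constants. The reduced problem keeps the condition at `1`, since for positive `b`
the layer sits at `0`. -/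
lemma exists_reduced_solution {n : ℕ} {a g : ℝ → ℝ} (ha : ContDiff ℝ n a) (hg : ContDiff ℝ n g) :
    ∃ v : ℝ → ℝ, ContDiff ℝ (n + 1 : ℕ) v ∧ v 1 = 0 ∧ ∀ x, HasDerivAt v (a x * v x - g x) x := by
  have hA : ∀ x, HasDerivAt (fun x => ∫ t in (0 : ℝ)..x, a t) (a x) x :=
    hasDerivAt_primitive ha.continuous 0
  have hAc := contDiff_primitive ha 0
  set A : ℝ → ℝ := fun x => ∫ t in (0 : ℝ)..x, a t
  have hEg : ContDiff ℝ n (fun x => Real.exp (-A x) * g x) :=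
    ((contDiff_of_le hAc (Nat.le_succ n)).neg.exp).mul hg
  have hI := hasDerivAt_primitive hEg.continuous 1
  have hIc := contDiff_primitive hEg 1
  refine ⟨fun x => -(Real.exp (A x) * ∫ t in (1 : ℝ)..x, Real.exp (-A t) * g t),
    (hAc.exp.mul hIc).neg, by simp, fun x => ?_⟩
  refine (((hA x).exp.mul (hI x)).neg).congr_deriv ?_
  have : Real.exp (A x) * Real.exp (-A x) = 1 := by rw [← Real.exp_add]; simp
  linear_combination (-g x) * this

lemma exists_bound_iteratedDeriv {n l : ℕ} {v : ℝ → ℝ} (hv : ContDiff ℝ l v) (hl : n ≤ l) :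
    ∃ C, 0 ≤ C ∧ ∀ x ∈ Icc (0 : ℝ) 1, ∀ j ≤ n, |iteratedDeriv j v x| ≤ C := by
  have h1 : ∀ j ≤ n, ∃ C, ∀ x ∈ Icc (0 : ℝ) 1, |iteratedDeriv j v x| ≤ C := fun j hj =>
    isCompact_Icc.exists_bound_of_continuousOn
      (hv.continuous_iteratedDeriv j (by exact_mod_cast hj.trans hl)).continuousOn
  choose! D hD using h1
  refine ⟨∑ j ∈ Finset.range (n + 1), |D j|, Finset.sum_nonneg fun _ _ => abs_nonneg _, ?_⟩
  intro x hx j hj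
  exact ((hD j hj x hx).trans (le_abs_self _)).trans
    (Finset.single_le_sum (f := fun j => |D j|) (fun _ _ => abs_nonneg _)
      (Finset.mem_range.2 (by omega)))

/-- Truncated outer expansion: `S ε` is bounded in `C^n` and solves the differential equation up to
`ε^(M+1)`. -/
lemma exists_smooth_part {n : ℕ} {b c p : ℝ → ℝ} (hbp : ∀ x ∈ Icc (0 : ℝ) 1, b x * p x = 1) (M : ℕ) :
    ContDiff ℝ (n + M + 1 : ℕ) c → ContDiff ℝ (n + M + 1 : ℕ) p →
    ∀ F : ℝ → ℝ, ContDiff ℝ (n + M + 1 : ℕ) F →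
    ∃ (S : ℝ → ℝ → ℝ) (g : ℝ → ℝ) (C : ℝ), ContDiff ℝ n g ∧ 0 ≤ C ∧
      (∀ ε, ContDiff ℝ (n + 2 : ℕ) (S ε)) ∧ (∀ ε, S ε 1 = 0) ∧
      (∀ ε ∈ Icc (0 : ℝ) 1, ∀ x ∈ Icc (0 : ℝ) 1, ∀ j ≤ n, |iteratedDeriv j (S ε) x| ≤ C) ∧
      ∀ ε, ∀ x ∈ Icc (0 : ℝ) 1,
        -ε * deriv (deriv (S ε)) x - b x * deriv (S ε) x + c x * S ε x = F x - ε ^ (M + 1) * g x := by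
  induction M with
  | zero =>
    intro hc hp F hF
    obtain ⟨v, hv, hv1, hvd⟩ := exists_reduced_solution (hp.mul hc) (hp.mul hF)
    obtain ⟨C, hC, hCb⟩ := exists_bound_iteratedDeriv (n := n) hv (by omega)
    refine ⟨fun _ => v, deriv (deriv v), C, contDiff_deriv (contDiff_deriv hv), hC, fun _ => hv,
      fun _ => hv1, fun _ _ => hCb, fun ε x hx => ?_⟩
    have := hbp x hx
    rw [(hvd x).deriv]
    linear_combination (F x - c x * v x) * this
  | succ M ih =>
    intro hc hp F hF
    obtain ⟨v, hv, hv1, hvd⟩ := exists_reduced_solution (hp.mul hc) (hp.mul hF)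
    obtain ⟨C, hC, hCb⟩ := exists_bound_iteratedDeriv (n := n) hv (by omega)
    have hv'' : ContDiff ℝ (n + M + 1 : ℕ) (deriv (deriv v)) := contDiff_deriv (contDiff_deriv hv)
    -- The reduced solution `v` leaves the defect `-ε v''`. Adding `ε` times the expansion for the
    -- right-hand side `v''` removes it and gains one power of `ε`. One order of smoothness is lost:
    -- solving gains one and `v''` costs two.
    obtain ⟨S, g, D, hg, hD, hS, hS1, hSD, hSe⟩ := ih (contDiff_of_le hc (by omega))
      (contDiff_of_le hp (by omega)) _ hv''
    have hvn : ContDiff ℝ (n + 2 : ℕ) v := contDiff_of_le hv (by omega)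
    refine ⟨fun ε x => v x + ε * S ε x, g, C + D, hg, add_nonneg hC hD,
      fun ε => hvn.add (contDiff_const.mul (hS ε)), fun ε => by simp [hv1, hS1], ?_, ?_⟩
    · intro ε hε x hx j hj
      have h1 : ContDiffAt ℝ j v x := (contDiff_of_le hv (by omega)).contDiffAt
      have h2 : ContDiffAt ℝ j (S ε) x := (contDiff_of_le (hS ε) (by omega)).contDiffAt
      have h3 : iteratedDeriv j (fun x => v x + ε * S ε x) x
          = iteratedDeriv j v x + ε * iteratedDeriv j (S ε) x := by
        rw [iteratedDeriv_fun_add h1 (contDiffAt_const.mul h2), iteratedDeriv_const_mul_field]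
      rw [h3]
      refine (abs_add_le _ _).trans (add_le_add (hCb x hx j hj) ?_)
      rw [abs_mul, abs_of_nonneg hε.1]
      exact (mul_le_of_le_one_left (abs_nonneg _) hε.2).trans (hSD ε hε x hx j hj)
    · intro ε x hx
      have d1 : ∀ y, HasDerivAt v (deriv v y) y := fun y =>
        (hvn.differentiable (by simp) y).hasDerivAt
      have d2 : ∀ y, HasDerivAt (S ε) (deriv (S ε) y) y := fun y =>
        ((hS ε).differentiable (by simp) y).hasDerivAt
      have d3 : HasDerivAt (deriv v) (deriv (deriv v) x) x :=
        ((contDiff_deriv (n := n + 1) hvn).differentiable (by simp) x).hasDerivAt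
      have d4 : HasDerivAt (deriv (S ε)) (deriv (deriv (S ε)) x) x :=
        ((contDiff_deriv (n := n + 1) (hS ε)).differentiable (by simp) x).hasDerivAt
      have e1 : deriv (fun x => v x + ε * S ε x) = fun y => deriv v y + ε * deriv (S ε) y :=
        funext fun y => ((d1 y).add ((d2 y).const_mul ε)).deriv
      have e2 : deriv (fun y => deriv v y + ε * deriv (S ε) y) x
          = deriv (deriv v) x + ε * deriv (deriv (S ε)) x := (d3.add (d4.const_mul ε)).deriv
      rw [e1, e2]
      beta_reduce
      have h0 := hbp x hx
      have h1 := hSe ε x hx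
      rw [(hvd x).deriv]
      simp only [pow_succ] at h1 ⊢
      linear_combination (F x - c x * v x) * h0 + ε * h1

end BakhvalovFEM

namespace BakhvalovFEM

/-! ### Bounds for the layer part -/

/-- With a positive second derivative the point would also be a local minimum. The function would
then be locally constant, contradicting positivity. -/
lemma deriv_deriv_nonpos_of_isLocalMax {h : ℝ → ℝ} {x : ℝ} (hmax : IsLocalMax h x)
    (hc : ContinuousAt h x) : deriv (deriv h) x ≤ 0 := by
  by_contra! hpos
  have hmin := isLocalMin_of_deriv_deriv_pos hpos hmax.deriv_eq_zero hc
  have heq : h =ᶠ[nhds x] fun _ => h x := by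
    filter_upwards [hmax, hmin] with y h1 h2 using le_antisymm h1 h2
  have h2 : deriv (deriv h) x = 0 := by
    rw [(heq.deriv).deriv_eq]
    simp
  exact hpos.ne' h2

/-- Comparison without a sign condition on `c`: the positive strict supersolution `Φ` takes over
that role. If the maximum `t` of `r/Φ` exceeds `1`, then `r - tΦ` has an interior local maximum with
value `0`, so the operator applied to `r` there is at least `t` times that applied to `Φ`,
contradicting `hL`. -/
lemma le_of_barrier {ε : ℝ} {b c r Φ : ℝ → ℝ} (hε : 0 < ε) (hr : ContDiff ℝ 2 r)
    (hΦ : ContDiff ℝ 2 Φ) (hpos : ∀ x ∈ Icc (0 : ℝ) 1, 0 < Φ x) (h0 : r 0 ≤ Φ 0) (h1 : r 1 ≤ Φ 1)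
    (hL : ∀ x ∈ Ioo (0 : ℝ) 1, |-ε * deriv (deriv r) x - b x * deriv r x + c x * r x| <
      -ε * deriv (deriv Φ) x - b x * deriv Φ x + c x * Φ x) :
    ∀ x ∈ Icc (0 : ℝ) 1, r x ≤ Φ x := by
  obtain ⟨z, hz, hmax⟩ := isCompact_Icc.exists_isMaxOn (nonempty_Icc.2 (zero_le_one' ℝ))
    (hr.continuous.continuousOn.div hΦ.continuous.continuousOn fun x hx => (hpos x hx).ne')
  set t := r z / Φ z with ht
  have hle : ∀ x ∈ Icc (0 : ℝ) 1, r x ≤ t * Φ x := fun x hx =>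
    (div_le_iff₀ (hpos x hx)).1 (hmax hx)
  have hzt : r z = t * Φ z := by rw [ht, div_mul_cancel₀ _ (hpos z hz).ne']
  by_cases ht1 : t ≤ 1
  · intro x hx
    exact (hle x hx).trans (mul_le_of_le_one_left (hpos x hx).le ht1)
  exfalso
  push Not at ht1
  have hzi : z ∈ Ioo (0 : ℝ) 1 := by
    refine ⟨lt_of_le_of_ne hz.1 ?_, lt_of_le_of_ne hz.2 ?_⟩
    · rintro rfl
      nlinarith [hpos 0 hz]
    · rintro rfl
      nlinarith [hpos 1 hz]
  have dr : ∀ y, HasDerivAt r (deriv r y) y := fun y =>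
    (hr.differentiable (by simp) y).hasDerivAt
  have dΦ : ∀ y, HasDerivAt Φ (deriv Φ y) y := fun y =>
    (hΦ.differentiable (by simp) y).hasDerivAt
  have ddr : HasDerivAt (deriv r) (deriv (deriv r) z) z :=
    ((contDiff_deriv (n := 1) hr).differentiable (by simp) z).hasDerivAt
  have ddΦ : HasDerivAt (deriv Φ) (deriv (deriv Φ) z) z :=
    ((contDiff_deriv (n := 1) hΦ).differentiable (by simp) z).hasDerivAt
  set h : ℝ → ℝ := fun y => r y - t * Φ y with hh
  have dh : ∀ y, HasDerivAt h (deriv r y - t * deriv Φ y) y := fun y =>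
    (dr y).sub ((dΦ y).const_mul t)
  have hlm : IsLocalMax h z := by
    filter_upwards [Icc_mem_nhds hzi.1 hzi.2] with y hy
    have := hle y hy
    simp only [hh]
    linarith
  have e1 : deriv h = fun y => deriv r y - t * deriv Φ y := funext fun y => (dh y).deriv
  have e2 : deriv (deriv h) z = deriv (deriv r) z - t * deriv (deriv Φ) z := by
    rw [e1]
    exact (ddr.sub (ddΦ.const_mul t)).deriv
  have e3 := deriv_deriv_nonpos_of_isLocalMax hlm (dh z).continuousAt
  have e4 := hlm.hasDerivAt_eq_zero (dh z)
  rw [e2] at e3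
  have e5 := hL z hzi
  have e6 := abs_lt.1 e5
  have e7 := (abs_nonneg _).trans_lt e5
  have e8 : -ε * deriv (deriv r) z - b z * deriv r z + c z * r z
      = -ε * (deriv (deriv r) z - t * deriv (deriv Φ) z)
        + t * (-ε * deriv (deriv Φ) z - b z * deriv Φ z + c z * Φ z) := by
    rw [hzt]
    linear_combination (-b z) * e4
  nlinarith

/-- The weight `e^{-β x / ε} + τ` controlling the layer part. -/
def layerWeight (β ε τ x : ℝ) : ℝ := Real.exp (-(β * x / ε)) + τ

lemma layerWeight_pos {β ε τ x : ℝ} (hτ : 0 ≤ τ) : 0 < layerWeight β ε τ x :=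
  add_pos_of_pos_of_nonneg (Real.exp_pos _) hτ

lemma le_layerWeight {β ε τ x : ℝ} : τ ≤ layerWeight β ε τ x :=
  le_add_of_nonneg_left (Real.exp_pos _).le

lemma layerWeight_le_of_sub_le {β ε τ x y s : ℝ} (hβ : 0 ≤ β) (hε : 0 < ε) (hτ : 0 ≤ τ) (hs : 0 ≤ s)
    (h : x - y ≤ s * ε) : layerWeight β ε τ y ≤ Real.exp (β * s) * layerWeight β ε τ x := by
  unfold layerWeight
  rw [mul_add, ← Real.exp_add]
  refine add_le_add (Real.exp_le_exp.2 ?_) (le_mul_of_one_le_left hτ (Real.one_le_exp (by positivity)))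
  have : β * (x - y) / ε ≤ β * s := by
    rw [div_le_iff₀ hε, mul_assoc]
    exact mul_le_mul_of_nonneg_left h hβ
  have h2 : β * (x - y) / ε = β * x / ε - β * y / ε := by ring
  linarith

lemma exists_layer_bound {b c g : ℝ → ℝ} {β β' R : ℝ} (hc : Continuous c)
    (hg : Continuous g) (hβ' : 0 < β') (hββ : β' < β) (hb : ∀ x ∈ Icc (0 : ℝ) 1, β ≤ b x)
    (hR : 0 ≤ R) :
    ∃ ε₀ C : ℝ, 0 < ε₀ ∧ 1 ≤ C ∧ ∀ ε τ : ℝ, 0 < ε → ε ≤ ε₀ → 0 < τ → ∀ r : ℝ → ℝ, ContDiff ℝ 2 r →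
      (∀ x ∈ Ioo (0 : ℝ) 1, -ε * deriv (deriv r) x - b x * deriv r x + c x * r x = τ * g x) →
      |r 0| ≤ R → r 1 = 0 → ∀ x ∈ Icc (0 : ℝ) 1, |r x| ≤ C * layerWeight β' ε τ x := by
  obtain ⟨c₀, hc₀⟩ := isCompact_Icc.exists_bound_of_continuousOn (s := Icc (0 : ℝ) 1) hc.continuousOn
  obtain ⟨g₀, hg₀⟩ := isCompact_Icc.exists_bound_of_continuousOn (s := Icc (0 : ℝ) 1) hg.continuousOn
  have hc0 : 0 ≤ c₀ := (norm_nonneg _).trans (hc₀ 0 (by simp))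
  have hg0 : 0 ≤ g₀ := (norm_nonneg _).trans (hg₀ 0 (by simp))
  have hβ : 0 < β := hβ'.trans hββ
  -- Chosen so that `b * lam + c ≥ 2`. Then `-ε lam² + b lam + c ≥ 1` as soon as `ε lam² ≤ 1`,
  -- whatever the sign of `c`.
  set lam : ℝ := (c₀ + 2) / β with hlam
  have hlam0 : 0 < lam := by positivity
  have hlamβ : lam * β = c₀ + 2 := by rw [hlam]; field_simp
  refine ⟨min (1 / lam ^ 2) (β' * (β - β') / (c₀ + 1)), R + (g₀ + 1) * Real.exp lam,
    lt_min (by positivity) (div_pos (mul_pos hβ' (sub_pos.2 hββ)) (by positivity)), ?_, ?_⟩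
  · have := Real.one_le_exp hlam0.le
    nlinarith
  intro ε τ hε hε0 hτ r hr hL h0 h1
  have hε1 : ε * lam ^ 2 ≤ 1 := (le_div_iff₀ (by positivity)).1 (hε0.trans (min_le_left _ _))
  have hε2 : ε * (c₀ + 1) ≤ β' * (β - β') :=
    (le_div_iff₀ (by positivity)).1 (hε0.trans (min_le_right _ _))
  -- The first term dominates the boundary value at `0`, the second the right-hand side `τ g`. The
  -- gap `β' < β` makes the first a supersolution for small `ε`, its leading part being `β'(b -
  -- β')/ε`.
  set Φ : ℝ → ℝ := fun x =>
    R * Real.exp (-(β' / ε) * x) + (g₀ + 1) * τ * Real.exp (lam - lam * x) with hΦ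
  have d1 : ∀ x, HasDerivAt Φ (R * (-(β' / ε)) * Real.exp (-(β' / ε) * x)
      + (g₀ + 1) * τ * (-lam) * Real.exp (lam - lam * x)) x := by
    intro x
    have e1 : HasDerivAt (fun x : ℝ => -(β' / ε) * x) (-(β' / ε)) x := by
      simpa using (hasDerivAt_id x).const_mul (-(β' / ε))
    have e2 : HasDerivAt (fun x : ℝ => lam - lam * x) (-lam) x := by
      simpa using ((hasDerivAt_id x).const_mul lam).const_sub lam
    exact ((e1.exp.const_mul R).add (e2.exp.const_mul ((g₀ + 1) * τ))).congr_deriv (by ring)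
  have d2 : ∀ x, deriv (deriv Φ) x = R * (β' / ε) ^ 2 * Real.exp (-(β' / ε) * x)
      + (g₀ + 1) * τ * lam ^ 2 * Real.exp (lam - lam * x) := by
    intro x
    rw [funext fun x => (d1 x).deriv]
    have e1 : HasDerivAt (fun x : ℝ => -(β' / ε) * x) (-(β' / ε)) x := by
      simpa using (hasDerivAt_id x).const_mul (-(β' / ε))
    have e2 : HasDerivAt (fun x : ℝ => lam - lam * x) (-lam) x := by
      simpa using ((hasDerivAt_id x).const_mul lam).const_sub lam
    refine (((e1.exp.const_mul (R * (-(β' / ε)))).add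
      (e2.exp.const_mul ((g₀ + 1) * τ * (-lam)))).congr_deriv ?_).deriv
    ring
  have hΦpos : ∀ x ∈ Icc (0 : ℝ) 1, 0 < Φ x := fun x _ => by positivity
  have hΦc : ContDiff ℝ 2 Φ := by
    have : ContDiff ℝ 2 fun x : ℝ => Real.exp (-(β' / ε) * x) := (contDiff_const.mul contDiff_id).exp
    have h' : ContDiff ℝ 2 fun x : ℝ => Real.exp (lam - lam * x) :=
      (contDiff_const.sub (contDiff_const.mul contDiff_id)).exp
    exact (contDiff_const.mul this).add (contDiff_const.mul h')
  have hLΦ : ∀ x ∈ Ioo (0 : ℝ) 1, |τ * g x| <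
      -ε * deriv (deriv Φ) x - b x * deriv Φ x + c x * Φ x := by
    intro x hx
    have hx' := Ioo_subset_Icc_self hx
    have hbx := hb x hx'
    have hcx := abs_le.1 (hc₀ x hx')
    have hgx : |g x| ≤ g₀ := hg₀ x hx'
    have hω : 1 ≤ Real.exp (lam - lam * x) := Real.one_le_exp (by nlinarith [hx.2])
    have hE := Real.exp_pos (-(β' / ε) * x)
    set E := Real.exp (-(β' / ε) * x)
    set ω := Real.exp (lam - lam * x)
    have k1 : 0 ≤ -ε * (β' / ε) ^ 2 + b x * (β' / ε) + c x := by
      have : -ε * (β' / ε) ^ 2 + b x * (β' / ε) + c x = (β' * (b x - β') + ε * c x) / ε := by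
        field_simp
        ring
      rw [this]
      refine div_nonneg ?_ hε.le
      nlinarith
    have k2 : 1 ≤ -ε * lam ^ 2 + b x * lam + c x := by nlinarith
    have k3 : -ε * deriv (deriv Φ) x - b x * deriv Φ x + c x * Φ x
        = R * E * (-ε * (β' / ε) ^ 2 + b x * (β' / ε) + c x)
          + (g₀ + 1) * τ * ω * (-ε * lam ^ 2 + b x * lam + c x) := by
      rw [d2, (d1 x).deriv]
      simp only [hΦ]
      ring
    rw [k3, abs_mul, abs_of_pos hτ]
    have k4 : 0 ≤ R * E * (-ε * (β' / ε) ^ 2 + b x * (β' / ε) + c x) := by positivity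
    have k5 : 1 ≤ ω * (-ε * lam ^ 2 + b x * lam + c x) := one_le_mul_of_one_le_of_one_le hω k2
    have k6 : (g₀ + 1) * τ * 1 ≤ (g₀ + 1) * τ * (ω * (-ε * lam ^ 2 + b x * lam + c x)) :=
      mul_le_mul_of_nonneg_left k5 (by positivity)
    have k7 : τ * |g x| ≤ τ * g₀ := mul_le_mul_of_nonneg_left hgx hτ.le
    nlinarith
  have hΦ0 : R ≤ Φ 0 := by
    simp only [hΦ, mul_zero, Real.exp_zero, mul_one]
    have : 0 ≤ (g₀ + 1) * τ * Real.exp (lam - 0) := by positivity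
    linarith
  have hup := le_of_barrier hε hr hΦc hΦpos ((le_abs_self _).trans (h0.trans hΦ0))
    (h1 ▸ (hΦpos 1 (by simp)).le) (fun x hx => by rw [hL x hx]; exact hLΦ x hx)
  have hdn := le_of_barrier (r := fun x => -r x) hε hr.neg hΦc hΦpos
    ((neg_le_abs _).trans (h0.trans hΦ0))
    (by simpa [h1] using (hΦpos 1 (by simp)).le) (fun x hx => by
      have e1 : deriv (fun x => -r x) = fun x => -deriv r x := by
        ext y
        simp
      have e2 : deriv (fun x => -deriv r x) x = -deriv (deriv r) x := by simp
      rw [e1, e2]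
      have := hLΦ x hx
      rw [← hL x hx, ← abs_neg] at this
      convert this using 2
      ring)
  intro x hx
  have hfin : Φ x ≤ (R + (g₀ + 1) * Real.exp lam) * layerWeight β' ε τ x := by
    have e1 : -(β' / ε) * x = -(β' * x / ε) := by ring
    have e2 : Real.exp (lam - lam * x) ≤ Real.exp lam := Real.exp_le_exp.2 (by nlinarith [hx.1])
    simp only [hΦ, layerWeight, e1]
    have e3 := Real.exp_pos (-(β' * x / ε))
    have e4 : (g₀ + 1) * τ * Real.exp (lam - lam * x) ≤ (g₀ + 1) * τ * Real.exp lam :=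
      mul_le_mul_of_nonneg_left e2 (by positivity)
    have e5 : 0 ≤ (g₀ + 1) * Real.exp lam * Real.exp (-(β' * x / ε)) := by positivity
    have e6 : 0 ≤ R * τ := by positivity
    nlinarith
  exact (abs_le.2 ⟨by linarith [hdn x hx], hup x hx⟩).trans hfin

/-- The mean value theorem on a window of length `ε` yields a point `ξ` with `ε |r'(ξ)| ≤ 2K`. The
flux `ε r' + b r` has derivative `(b' + c) r - τ g`, free of negative powers of `ε`, so the bound is
carried from `ξ` to `x`. -/
lemma abs_deriv_le_of_window {ε τ p D K x : ℝ} {b c g r : ℝ → ℝ} (hε : 0 < ε) (hε1 : ε ≤ 1)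
    (hτ : 0 ≤ τ) (hb : ContDiff ℝ 1 b) (hr : ContDiff ℝ 2 r)
    (hx : x ∈ Icc p (p + ε))
    (hL : ∀ x ∈ Icc p (p + ε),
      -ε * deriv (deriv r) x - b x * deriv r x + c x * r x = τ * g x)
    (hbD : ∀ x ∈ Icc p (p + ε), |b x| ≤ D) (hcD : ∀ x ∈ Icc p (p + ε), |deriv b x + c x| ≤ D)
    (hgD : ∀ x ∈ Icc p (p + ε), |g x| ≤ D) (hrK : ∀ x ∈ Icc p (p + ε), |r x| ≤ K) (hτK : τ ≤ K) :
    ε * |deriv r x| ≤ (2 + 4 * D) * K := by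
  have hp : p ∈ Icc p (p + ε) := ⟨le_rfl, by linarith⟩
  have hpe : p + ε ∈ Icc p (p + ε) := ⟨by linarith, le_rfl⟩
  have hD : 0 ≤ D := (abs_nonneg _).trans (hbD p hp)
  have hK : 0 ≤ K := (abs_nonneg _).trans (hrK p hp)
  have dr : ∀ y, HasDerivAt r (deriv r y) y := fun y =>
    (hr.differentiable (by simp) y).hasDerivAt
  have ddr : ∀ y, HasDerivAt (deriv r) (deriv (deriv r) y) y := fun y =>
    ((contDiff_deriv (n := 1) hr).differentiable (by simp) y).hasDerivAt
  have db : ∀ y, HasDerivAt b (deriv b y) y := fun y =>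
    (hb.differentiable (by simp) y).hasDerivAt
  obtain ⟨ξ, hξ, hξe⟩ := exists_deriv_eq_slope r (show p < p + ε by linarith)
    hr.continuous.continuousOn (fun y _ => (dr y).differentiableAt.differentiableWithinAt)
  have hξ' := Ioo_subset_Icc_self hξ
  have h1 : ε * |deriv r ξ| ≤ 2 * K := by
    rw [hξe, add_sub_cancel_left, abs_div, abs_of_pos hε, mul_div_cancel₀ _ hε.ne']
    refine (abs_sub _ _).trans ?_
    linarith [hrK _ hp, hrK _ hpe]
  have h2 : ‖(ε * deriv r x + b x * r x) - (ε * deriv r ξ + b ξ * r ξ)‖ ≤ 2 * D * K * ‖x - ξ‖ := by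
    refine (convex_Icc p (p + ε)).norm_image_sub_le_of_norm_hasDerivWithin_le
      (f := fun y => ε * deriv r y + b y * r y) (f' := fun y => (deriv b y + c y) * r y - τ * g y)
      (fun y hy => ?_) (fun y hy => ?_) hξ' hx
    · refine (((ddr y).const_mul ε).add ((db y).mul (dr y))).hasDerivWithinAt.congr_deriv ?_
      linear_combination -(hL y hy)
    · refine (norm_sub_le _ _).trans ?_
      rw [Real.norm_eq_abs, Real.norm_eq_abs, abs_mul, abs_mul, abs_of_nonneg hτ]
      have e1 : |deriv b y + c y| * |r y| ≤ D * K :=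
        mul_le_mul (hcD y hy) (hrK y hy) (abs_nonneg _) hD
      have e2 : τ * |g y| ≤ K * D := mul_le_mul hτK (hgD y hy) (abs_nonneg _) hK
      linarith
  have h3 : ‖x - ξ‖ ≤ 1 := by
    rw [Real.norm_eq_abs, abs_le]
    constructor <;> linarith [hx.1, hx.2, hξ'.1, hξ'.2]
  have h4 : 2 * D * K * ‖x - ξ‖ ≤ 2 * D * K := mul_le_of_le_one_right (by positivity) h3
  have h5 : |b x * r x| ≤ D * K := by
    rw [abs_mul]; exact mul_le_mul (hbD x hx) (hrK x hx) (abs_nonneg _) hD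
  have h6 : |b ξ * r ξ| ≤ D * K := by
    rw [abs_mul]; exact mul_le_mul (hbD ξ hξ') (hrK ξ hξ') (abs_nonneg _) hD
  have h7 : ε * |deriv r x| = |ε * deriv r x| := by rw [abs_mul, abs_of_pos hε]
  have h8 : ε * |deriv r ξ| = |ε * deriv r ξ| := by rw [abs_mul, abs_of_pos hε]
  rw [h8] at h1
  rw [h7]
  have h9 := h2.trans h4
  rw [Real.norm_eq_abs] at h9
  rw [abs_le] at h1 h5 h6 h9 ⊢
  constructor <;> linarith [h1.1, h1.2, h5.1, h5.2, h6.1, h6.2, h9.1, h9.2]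

/-- The equation differentiated `j` times expresses `ε r^(j+2)` through lower derivatives. The
argument is pointwise in `x`, so `K` may later be a multiple of the layer weight at `x`. -/
lemma exists_bound_iteratedDeriv_of_equation {n : ℕ} {b c g : ℝ → ℝ} (hb : ContDiff ℝ n b)
    (hc : ContDiff ℝ n c) (hg : ContDiff ℝ n g) (j : ℕ) : j ≤ n + 1 →
    ∃ A : ℝ, 1 ≤ A ∧ ∀ (ε τ K x : ℝ) (r : ℝ → ℝ), 0 < ε → ε ≤ 1 → 0 ≤ τ → τ ≤ K →
      ContDiff ℝ (n + 2 : ℕ) r → x ∈ Ioo (0 : ℝ) 1 →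
      (∀ x ∈ Ioo (0 : ℝ) 1, -ε * deriv (deriv r) x - b x * deriv r x + c x * r x = τ * g x) →
      |r x| ≤ K → ε * |deriv r x| ≤ K →
      ∀ i ≤ j, ε ^ i * |iteratedDeriv i r x| ≤ A * K := by
  obtain ⟨B, hB, hbB⟩ := exists_bound_iteratedDeriv hb le_rfl
  obtain ⟨C, hC, hcC⟩ := exists_bound_iteratedDeriv hc le_rfl
  obtain ⟨G, hG, hgG⟩ := exists_bound_iteratedDeriv hg le_rfl
  induction j with
  | zero =>
    intro _
    refine ⟨1, le_rfl, ?_⟩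
    intro ε τ K x r _ _ _ _ _ _ _ h0 _ i hi
    obtain rfl : i = 0 := by omega
    simpa using h0
  | succ j ih =>
    intro hj
    obtain ⟨A, hA, hAb⟩ := ih (by omega)
    rcases j with _ | j
    · refine ⟨A, hA, ?_⟩
      intro ε τ K x r hε hε1 hτ hτK hr hx hL h0 h1 i hi
      have hK : K ≤ A * K := le_mul_of_one_le_left (hτ.trans hτK) hA
      rcases Nat.lt_or_ge i 1 with h | h
      · exact hAb ε τ K x r hε hε1 hτ hτK hr hx hL h0 h1 i (by omega)
      · obtain rfl : i = 1 := by omega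
        simpa using h1.trans hK
    refine ⟨A + (B * A + C * A) * ∑ l ∈ Finset.range (j + 1), (j.choose l : ℝ) + G, ?_, ?_⟩
    · have : 0 ≤ (B * A + C * A) * ∑ l ∈ Finset.range (j + 1), (j.choose l : ℝ) := by positivity
      linarith
    intro ε τ K x r hε hε1 hτ hτK hr hx hL h0 h1 i hi
    have hK : 0 ≤ K := hτ.trans hτK
    have hs0 : 0 ≤ (B * A + C * A) * ∑ l ∈ Finset.range (j + 1), (j.choose l : ℝ) := by positivity
    have hprev := hAb ε τ K x r hε hε1 hτ hτK hr hx hL h0 h1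
    rcases Nat.lt_or_ge i (j + 2) with h | h
    · refine (hprev i (by omega)).trans (mul_le_mul_of_nonneg_right ?_ hK)
      linarith
    obtain rfl : i = j + 2 := by omega
    have hx' := Ioo_subset_Icc_self hx
    have hdr : ContDiff ℝ (n + 1 : ℕ) (deriv r) := contDiff_deriv hr
    have hev : deriv (deriv r) =ᶠ[nhds x]
        fun y => (1 / ε) * ((c y * r y - b y * deriv r y) - τ * g y) := by
      filter_upwards [Ioo_mem_nhds hx.1 hx.2] with y hy
      field_simp
      linear_combination -(hL y hy)
    have hbj : ContDiffAt ℝ j b x := (contDiff_of_le hb (by omega)).contDiffAt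
    have hcj : ContDiffAt ℝ j c x := (contDiff_of_le hc (by omega)).contDiffAt
    have hgj : ContDiffAt ℝ j g x := (contDiff_of_le hg (by omega)).contDiffAt
    have hrj : ContDiffAt ℝ j r x := (contDiff_of_le hr (by omega)).contDiffAt
    have hdrj : ContDiffAt ℝ j (deriv r) x := (contDiff_of_le hdr (by omega)).contDiffAt
    have hid : ε * iteratedDeriv (j + 2) r x = iteratedDeriv j (fun y => c y * r y) x
        - iteratedDeriv j (fun y => b y * deriv r y) x - τ * iteratedDeriv j g x := by
      rw [iteratedDeriv_succ', iteratedDeriv_succ', hev.iteratedDeriv_eq,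
        iteratedDeriv_const_mul_field,
        iteratedDeriv_fun_sub ((hcj.mul hrj).sub (hbj.mul hdrj)) (contDiffAt_const.mul hgj),
        iteratedDeriv_fun_sub (hcj.mul hrj) (hbj.mul hdrj), iteratedDeriv_const_mul_field]
      field_simp
    -- In the Leibniz sum every lower derivative comes with at least the power of `ε` that its own
    -- bound requires, because `ε ≤ 1`.
    have hp1 : ε ^ (j + 1) * |iteratedDeriv j (fun y => c y * r y) x| ≤
        C * A * K * ∑ l ∈ Finset.range (j + 1), (j.choose l : ℝ) := by
      rw [iteratedDeriv_fun_mul hcj hrj, Finset.mul_sum]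
      refine (mul_le_mul_of_nonneg_left (Finset.abs_sum_le_sum_abs _ _) (by positivity)).trans ?_
      rw [Finset.mul_sum]
      refine Finset.sum_le_sum fun l hl => ?_
      have hl' := Finset.mem_range.1 hl
      rw [abs_mul, abs_mul, Nat.abs_cast]
      have e1 := hcC x hx' l (by omega)
      have e2 := hprev (j - l) (by omega)
      have e3 : ε ^ (j + 1) ≤ ε ^ (j - l) := pow_le_pow_of_le_one hε.le hε1 (by omega)
      have e4 : ε ^ (j + 1) * |iteratedDeriv (j - l) r x| ≤ A * K :=
        (mul_le_mul_of_nonneg_right e3 (abs_nonneg _)).trans e2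
      have e5 := mul_le_mul e1 e4 (by positivity) hC
      have e6 := mul_le_mul_of_nonneg_left e5 (Nat.cast_nonneg (α := ℝ) (j.choose l))
      linarith
    have hp2 : ε ^ (j + 1) * |iteratedDeriv j (fun y => b y * deriv r y) x| ≤
        B * A * K * ∑ l ∈ Finset.range (j + 1), (j.choose l : ℝ) := by
      rw [iteratedDeriv_fun_mul hbj hdrj, Finset.mul_sum]
      refine (mul_le_mul_of_nonneg_left (Finset.abs_sum_le_sum_abs _ _) (by positivity)).trans ?_
      rw [Finset.mul_sum]
      refine Finset.sum_le_sum fun l hl => ?_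
      have hl' := Finset.mem_range.1 hl
      rw [abs_mul, abs_mul, Nat.abs_cast, ← iteratedDeriv_succ']
      have e1 := hbB x hx' l (by omega)
      have e2 := hprev (j - l + 1) (by omega)
      have e3 : ε ^ (j + 1) ≤ ε ^ (j - l + 1) := pow_le_pow_of_le_one hε.le hε1 (by omega)
      have e4 : ε ^ (j + 1) * |iteratedDeriv (j - l + 1) r x| ≤ A * K :=
        (mul_le_mul_of_nonneg_right e3 (abs_nonneg _)).trans e2
      have e5 := mul_le_mul e1 e4 (by positivity) hB
      have e6 := mul_le_mul_of_nonneg_left e5 (Nat.cast_nonneg (α := ℝ) (j.choose l))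
      linarith
    have hp3 : ε ^ (j + 1) * (τ * |iteratedDeriv j g x|) ≤ K * G := by
      have e1 := mul_le_mul hτK (hgG x hx' j (by omega)) (abs_nonneg _) hK
      exact (mul_le_of_le_one_left (by positivity) (pow_le_one₀ hε.le hε1)).trans e1
    have hfin : ε ^ (j + 2) * |iteratedDeriv (j + 2) r x|
        = ε ^ (j + 1) * |ε * iteratedDeriv (j + 2) r x| := by
      rw [abs_mul, abs_of_pos hε]
      ring
    rw [hfin, hid]
    have e1 := abs_sub (iteratedDeriv j (fun y => c y * r y) x
        - iteratedDeriv j (fun y => b y * deriv r y) x) (τ * iteratedDeriv j g x)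
    have e2 := abs_sub (iteratedDeriv j (fun y => c y * r y) x)
      (iteratedDeriv j (fun y => b y * deriv r y) x)
    rw [abs_mul τ, abs_of_nonneg hτ] at e1
    have e3 := mul_le_mul_of_nonneg_left (e1.trans (add_le_add_left e2 _)) (pow_pos hε (j + 1)).le
    refine e3.trans ?_
    have e4 : 0 ≤ A * K := by positivity
    linarith

/-- Derivative bounds for the layer part of the solution. -/
lemma exists_layer_derivative_bound {n : ℕ} {b c g : ℝ → ℝ} {β β' R : ℝ} (hn : 1 ≤ n)
    (hb : ContDiff ℝ n b) (hc : ContDiff ℝ n c) (hg : ContDiff ℝ n g) (hβ' : 0 < β') (hββ : β' < β)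
    (hbβ : ∀ x ∈ Icc (0 : ℝ) 1, β ≤ b x) (hR : 0 ≤ R) :
    ∃ ε₀ C : ℝ, 0 < ε₀ ∧ 0 ≤ C ∧ ∀ ε τ : ℝ, 0 < ε → ε ≤ ε₀ → 0 < τ →
      ∀ r : ℝ → ℝ, ContDiff ℝ (n + 2 : ℕ) r →
      (∀ x ∈ Icc (0 : ℝ) 1, -ε * deriv (deriv r) x - b x * deriv r x + c x * r x = τ * g x) →
      |r 0| ≤ R → r 1 = 0 → ∀ i ≤ n + 1, ∀ x ∈ Icc (0 : ℝ) 1,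
        ε ^ i * |iteratedDeriv i r x| ≤ C * layerWeight β' ε τ x := by
  obtain ⟨ε₀, C, hε₀, hC, hbound⟩ := exists_layer_bound hc.continuous hg.continuous hβ' hββ hbβ hR
  obtain ⟨A, hA, hAb⟩ := exists_bound_iteratedDeriv_of_equation hb hc hg (n + 1) le_rfl
  have hb1 : ContDiff ℝ (0 + 1 : ℕ) b := contDiff_of_le hb hn
  obtain ⟨D₁, hD₁⟩ := isCompact_Icc.exists_bound_of_continuousOn (s := Icc (0 : ℝ) 1)
    hb.continuous.continuousOn
  obtain ⟨D₂, hD₂⟩ := isCompact_Icc.exists_bound_of_continuousOn (s := Icc (0 : ℝ) 1)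
    ((contDiff_deriv hb1).continuous.add hc.continuous).continuousOn
  obtain ⟨D₃, hD₃⟩ := isCompact_Icc.exists_bound_of_continuousOn (s := Icc (0 : ℝ) 1)
    hg.continuous.continuousOn
  set D := max D₁ (max D₂ D₃) with hDdef
  have hD : 0 ≤ D := ((norm_nonneg _).trans (hD₁ 0 (by simp))).trans (le_max_left _ _)
  refine ⟨min ε₀ (1 / 2), A * ((2 + 4 * D) * (C * Real.exp β')), lt_min hε₀ (by norm_num),
    by positivity, ?_⟩
  intro ε τ hε hεle hτ r hr hL h0 h1 i hi
  have hε2 : ε ≤ 1 / 2 := hεle.trans (min_le_right _ _)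
  have hr2 : ContDiff ℝ 2 r := contDiff_of_le (n := 2) hr (by omega)
  have hr0 := hbound ε τ hε (hεle.trans (min_le_left _ _)) hτ r hr2
    (fun x hx => hL x (Ioo_subset_Icc_self hx)) h0 h1
  have hmain : ∀ x ∈ Ioo (0 : ℝ) 1, ε ^ i * |iteratedDeriv i r x| ≤
      A * ((2 + 4 * D) * (C * Real.exp β')) * layerWeight β' ε τ x := by
    intro x hx
    -- The window extends to the right of `x` in the left half of the interval and to the left
    -- otherwise. With `ε ≤ 1/2` it stays inside `[0,1]`.
    obtain ⟨p, hp0, hp1, hxp⟩ : ∃ p, 0 ≤ p ∧ p + ε ≤ 1 ∧ x ∈ Icc p (p + ε) := by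
      rcases le_total x (1 / 2) with h | h
      · exact ⟨x, hx.1.le, by linarith, le_rfl, by linarith⟩
      · exact ⟨x - ε, by linarith, by linarith [hx.2], by linarith, by linarith⟩
    have hsub : Icc p (p + ε) ⊆ Icc 0 1 := Icc_subset_Icc hp0 hp1
    have hφ := layerWeight_pos (β := β') (ε := ε) (x := x) hτ.le
    have hexp : 1 ≤ Real.exp β' := Real.one_le_exp hβ'.le
    have hCe : 1 ≤ C * Real.exp β' := one_le_mul_of_one_le_of_one_le hC hexp
    have hK : ∀ y ∈ Icc p (p + ε), |r y| ≤ C * Real.exp β' * layerWeight β' ε τ x := by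
      intro y hy
      refine (hr0 y (hsub hy)).trans ?_
      rw [mul_assoc]
      -- Across a window of length `ε` the weight changes at most by the factor `e^{β'}`.
      have := layerWeight_le_of_sub_le (x := x) (y := y) (s := 1) hβ'.le hε hτ.le zero_le_one
        (by linarith [hy.1, hxp.2])
      rw [mul_one] at this
      exact mul_le_mul_of_nonneg_left this (by linarith)
    have hτK : τ ≤ C * Real.exp β' * layerWeight β' ε τ x :=
      le_layerWeight.trans (le_mul_of_one_le_left hφ.le hCe)
    have hd := abs_deriv_le_of_window (D := D) hε (by linarith) hτ.le hb1 hr2 hxp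
      (fun y hy => hL y (hsub hy)) (fun y hy => (hD₁ y (hsub hy)).trans (le_max_left _ _))
      (fun y hy => (hD₂ y (hsub hy)).trans ((le_max_left _ _).trans (le_max_right _ _)))
      (fun y hy => (hD₃ y (hsub hy)).trans ((le_max_right _ _).trans (le_max_right _ _))) hK hτK
    have hle : C * Real.exp β' * layerWeight β' ε τ x ≤
        (2 + 4 * D) * (C * Real.exp β' * layerWeight β' ε τ x) :=
      le_mul_of_one_le_left (by positivity) (by linarith)
    have := hAb ε τ _ x r hε (by linarith) hτ.le (hτK.trans hle) hr hx
      (fun y hy => hL y (Ioo_subset_Icc_self hy)) ((hK x hxp).trans hle) hd i hi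
    refine this.trans (le_of_eq ?_)
    ring
  have hcl : closure (Ioo (0 : ℝ) 1) = Icc 0 1 := closure_Ioo zero_ne_one
  intro x hx
  have hcont1 : Continuous fun x => ε ^ i * |iteratedDeriv i r x| :=
    continuous_const.mul (hr.continuous_iteratedDeriv i (by exact_mod_cast (by omega))).abs
  have hcont2 : Continuous fun x =>
      A * ((2 + 4 * D) * (C * Real.exp β')) * layerWeight β' ε τ x := by
    unfold layerWeight
    fun_prop
  exact le_on_closure hmain hcont1.continuousOn hcont2.continuousOn (hcl ▸ hx)

end BakhvalovFEM

namespace BakhvalovFEM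

/-! ### Piecewise differentiable functions and the energy argument -/

/-- Lebesgue measure on `(0,1)`. -/
def unitMeasure : Measure ℝ := volume.restrict (Ioo 0 1)

instance : IsFiniteMeasure unitMeasure := by
  unfold unitMeasure
  infer_instance

lemma integral_unit (F : ℝ → ℝ) : ∫ x in (0 : ℝ)..1, F x = ∫ x, F x ∂unitMeasure := by
  rw [intervalIntegral.integral_of_le zero_le_one, integral_Ioc_eq_integral_Ioo, unitMeasure]

lemma ae_unitMeasure {s : Set ℝ} (hs : s.Countable) {P : ℝ → Prop}
    (h : ∀ x ∈ Ioo (0 : ℝ) 1 \ s, P x) : ∀ᵐ x ∂unitMeasure, P x := by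
  have h1 : ∀ᵐ x ∂unitMeasure, x ∈ Ioo (0 : ℝ) 1 := ae_restrict_mem measurableSet_Ioo
  have h2 : ∀ᵐ x ∂unitMeasure, x ∉ s := ae_restrict_of_ae (hs.ae_notMem _)
  filter_upwards [h1, h2] with x hx hxs using h x ⟨hx, hxs⟩

/-- Essentially bounded functions on `(0,1)`. -/
abbrev EssBdd (F : ℝ → ℝ) : Prop := MemLp F ⊤ unitMeasure

lemma essBdd_of_continuousOn {F : ℝ → ℝ} (h : ContinuousOn F (Icc 0 1)) : EssBdd F := by
  obtain ⟨C, hC⟩ := isCompact_Icc.exists_bound_of_continuousOn h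
  exact memLp_top_of_bound ((h.mono Ioo_subset_Icc_self).aestronglyMeasurable measurableSet_Ioo) C
    (ae_unitMeasure countable_empty fun x hx => hC x (Ioo_subset_Icc_self hx.1))

lemma EssBdd.mul' {F G : ℝ → ℝ} (hF : EssBdd F) (hG : EssBdd G) : EssBdd fun x => F x * G x :=
  MemLp.mul hG hF

lemma EssBdd.add' {F G : ℝ → ℝ} (hF : EssBdd F) (hG : EssBdd G) : EssBdd fun x => F x + G x :=
  MemLp.add hF hG

lemma EssBdd.sub' {F G : ℝ → ℝ} (hF : EssBdd F) (hG : EssBdd G) : EssBdd fun x => F x - G x :=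
  MemLp.sub hF hG

lemma EssBdd.integrable' {F : ℝ → ℝ} (hF : EssBdd F) : Integrable F unitMeasure :=
  hF.integrable le_top

lemma EssBdd.const (a : ℝ) : EssBdd fun _ => a := memLp_const a

/-- Continuous functions on `[0,1]` that are differentiable with bounded derivative off `s`. -/
structure PiecewiseDiff (s : Set ℝ) (v : ℝ → ℝ) : Prop where
  continuousOn : ContinuousOn v (Icc 0 1)
  differentiableAt : ∀ x ∈ Ioo (0 : ℝ) 1 \ s, DifferentiableAt ℝ v x
  bounded : ∃ K, ∀ x ∈ Ioo (0 : ℝ) 1 \ s, |deriv v x| ≤ K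

variable {s : Set ℝ} {v w : ℝ → ℝ}

lemma PiecewiseDiff.essBdd (hv : PiecewiseDiff s v) : EssBdd v :=
  essBdd_of_continuousOn hv.continuousOn

lemma PiecewiseDiff.essBdd_deriv (hs : s.Countable) (hv : PiecewiseDiff s v) :
    EssBdd (deriv v) := by
  obtain ⟨K, hK⟩ := hv.bounded
  exact memLp_top_of_bound (measurable_deriv v).aestronglyMeasurable K (ae_unitMeasure hs hK)

lemma PiecewiseDiff.add (hv : PiecewiseDiff s v) (hw : PiecewiseDiff s w) :
    PiecewiseDiff s fun x => v x + w x := by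
  obtain ⟨K, hK⟩ := hv.bounded
  obtain ⟨L, hL⟩ := hw.bounded
  refine ⟨hv.continuousOn.add hw.continuousOn,
    fun x hx => (hv.differentiableAt x hx).add (hw.differentiableAt x hx), K + L, fun x hx => ?_⟩
  rw [deriv_fun_add (hv.differentiableAt x hx) (hw.differentiableAt x hx)]
  exact (abs_add_le _ _).trans (add_le_add (hK x hx) (hL x hx))

lemma PiecewiseDiff.sub (hv : PiecewiseDiff s v) (hw : PiecewiseDiff s w) :
    PiecewiseDiff s fun x => v x - w x := by
  obtain ⟨K, hK⟩ := hv.bounded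
  obtain ⟨L, hL⟩ := hw.bounded
  refine ⟨hv.continuousOn.sub hw.continuousOn,
    fun x hx => (hv.differentiableAt x hx).sub (hw.differentiableAt x hx), K + L, fun x hx => ?_⟩
  rw [deriv_fun_sub (hv.differentiableAt x hx) (hw.differentiableAt x hx)]
  exact (abs_sub _ _).trans (add_le_add (hK x hx) (hL x hx))

lemma PiecewiseDiff.of_contDiff (s : Set ℝ) (hv : ContDiff ℝ 1 v) : PiecewiseDiff s v := by
  obtain ⟨C, hC⟩ := isCompact_Icc.exists_bound_of_continuousOn (s := Icc (0 : ℝ) 1)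
    (contDiff_deriv (n := 0) hv).continuous.continuousOn
  exact ⟨hv.continuous.continuousOn, fun x _ => hv.differentiable (by simp) x,
    C, fun x hx => hC x (Ioo_subset_Icc_self hx.1)⟩

lemma PiecewiseDiff.finiteEnergy (hs : s.Countable) (hv : PiecewiseDiff s v) : FiniteEnergy v :=
  ⟨hv.essBdd.mono_exponent le_top, (hv.essBdd_deriv hs).mono_exponent le_top⟩

lemma essBdd_parts {b : ℝ → ℝ} (hs : s.Countable) (hb : ContDiff ℝ 1 b)
    (hv : PiecewiseDiff s v) (hw : PiecewiseDiff s w) :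
    EssBdd fun x => deriv b x * v x * w x + b x * deriv v x * w x + b x * v x * deriv w x := by
  have hb' := essBdd_of_continuousOn (contDiff_deriv (n := 0) hb).continuous.continuousOn
  have hb0 := essBdd_of_continuousOn hb.continuous.continuousOn
  exact (((hb'.mul' hv.essBdd).mul' hw.essBdd).add'
      ((hb0.mul' (hv.essBdd_deriv hs)).mul' hw.essBdd)).add'
      ((hb0.mul' hv.essBdd).mul' (hw.essBdd_deriv hs))

/-- The integrand is `(b v w)'` off a countable set, and `b v w` vanishes at both ends. It serves to
move a derivative off the layer error, with `v = R`, and to obtain coercivity, with `v = w`. -/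
lemma integral_mul_mul_deriv_eq_zero {b : ℝ → ℝ} (hs : s.Countable) (hb : ContDiff ℝ 1 b)
    (hv : PiecewiseDiff s v) (hw : PiecewiseDiff s w) (hw0 : w 0 = 0) (hw1 : w 1 = 0) :
    ∫ x, (deriv b x * v x * w x + b x * deriv v x * w x + b x * v x * deriv w x) ∂unitMeasure
      = 0 := by
  have hint := essBdd_parts hs hb hv hw
  rw [← integral_unit, MeasureTheory.integral_eq_of_hasDerivAt_off_countable_of_le
    (fun x => b x * v x * w x)
    (fun x => deriv b x * v x * w x + b x * deriv v x * w x + b x * v x * deriv w x)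
    zero_le_one hs ((hb.continuous.continuousOn.mul hv.continuousOn).mul hw.continuousOn) ?_ ?_]
  · simp [hw0, hw1]
  · intro x hx
    refine ((((hb.differentiable (by simp) x).hasDerivAt.mul
      (hv.differentiableAt x hx).hasDerivAt).mul
      (hw.differentiableAt x hx).hasDerivAt)).congr_deriv ?_
    simp only [Pi.mul_apply]
    ring
  · rw [intervalIntegrable_iff_integrableOn_Ioo_of_le zero_le_one]
    exact hint.integrable'

lemma bilin_eq {ε : ℝ} {b c : ℝ → ℝ} (hs : s.Countable) (hb : Continuous b) (hc : Continuous c)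
    (hv : PiecewiseDiff s v) (hw : PiecewiseDiff s w) :
    bilin ε b c v w = ∫ x, (ε * (deriv v x * deriv w x) - b x * deriv v x * w x + c x * v x * w x)
      ∂unitMeasure := by
  have hb0 := essBdd_of_continuousOn hb.continuousOn
  have hc0 := essBdd_of_continuousOn hc.continuousOn
  have h1 : EssBdd fun x => ε * (deriv v x * deriv w x) :=
    (EssBdd.const ε).mul' ((hv.essBdd_deriv hs).mul' (hw.essBdd_deriv hs))
  have h2 : EssBdd fun x => b x * deriv v x * w x := (hb0.mul' (hv.essBdd_deriv hs)).mul' hw.essBdd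
  have h3 : EssBdd fun x => c x * v x * w x := (hc0.mul' hv.essBdd).mul' hw.essBdd
  rw [bilin, integral_unit, integral_unit, integral_unit,
    integral_add (EssBdd.integrable' (h1.sub' h2)) h3.integrable',
    integral_sub h1.integrable' h2.integrable', integral_const_mul]

lemma essBdd_bilin {ε : ℝ} {b c : ℝ → ℝ} (hs : s.Countable) (hb : Continuous b) (hc : Continuous c)
    (hv : PiecewiseDiff s v) (hw : PiecewiseDiff s w) :
    EssBdd fun x => ε * (deriv v x * deriv w x) - b x * deriv v x * w x + c x * v x * w x := by
  have hb0 := essBdd_of_continuousOn hb.continuousOn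
  have hc0 := essBdd_of_continuousOn hc.continuousOn
  exact (((EssBdd.const ε).mul' ((hv.essBdd_deriv hs).mul' (hw.essBdd_deriv hs))).sub'
    ((hb0.mul' (hv.essBdd_deriv hs)).mul' hw.essBdd)).add' ((hc0.mul' hv.essBdd).mul' hw.essBdd)

lemma energyNorm_sq_eq {ε : ℝ} (hs : s.Countable) (hv : PiecewiseDiff s v) :
    energyNorm ε v = √(∫ x, (ε * deriv v x ^ 2 + v x ^ 2) ∂unitMeasure) := by
  have h1 : EssBdd fun x => ε * deriv v x ^ 2 := by
    simp only [pow_two]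
    exact (EssBdd.const ε).mul' ((hv.essBdd_deriv hs).mul' (hv.essBdd_deriv hs))
  have h2 : EssBdd fun x => v x ^ 2 := by
    simp only [pow_two]
    exact hv.essBdd.mul' hv.essBdd
  rw [energyNorm, integral_unit, integral_unit, integral_add h1.integrable' h2.integrable',
    integral_const_mul]

lemma essBdd_energy {ε : ℝ} (hs : s.Countable) (hv : PiecewiseDiff s v) :
    EssBdd fun x => ε * deriv v x ^ 2 + v x ^ 2 := by
  simp only [pow_two]
  exact ((EssBdd.const ε).mul' ((hv.essBdd_deriv hs).mul' (hv.essBdd_deriv hs))).add'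
    (hv.essBdd.mul' hv.essBdd)

/-- The weak form of the differential equation. -/
lemma bilin_eq_of_equation {ε : ℝ} {b c f u : ℝ → ℝ} (hs : s.Countable) (hb : Continuous b)
    (hc : Continuous c) (hu : ContDiff ℝ 2 u)
    (hL : ∀ x ∈ Icc (0 : ℝ) 1, -ε * deriv (deriv u) x - b x * deriv u x + c x * u x = f x)
    (hv : PiecewiseDiff s v) (hv0 : v 0 = 0) (hv1 : v 1 = 0) :
    bilin ε b c u v = ∫ x in (0 : ℝ)..1, f x * v x := by
  have hu' : ContDiff ℝ 1 (deriv u) := contDiff_deriv (n := 1) hu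
  have hu1 : PiecewiseDiff s u := .of_contDiff s (hu.of_le (by norm_num))
  -- The coefficient `1` turns the product identity into ordinary integration by parts for `u'` and
  -- `v`.
  have hone : ContDiff ℝ 1 fun _ : ℝ => (1 : ℝ) := contDiff_const
  have hp := integral_mul_mul_deriv_eq_zero hs hone (PiecewiseDiff.of_contDiff s hu') hv hv0 hv1
  have hp' := essBdd_parts hs hone (PiecewiseDiff.of_contDiff s hu') hv
  rw [bilin_eq hs hb hc hu1 hv, integral_unit]
  have : ∀ᵐ x ∂unitMeasure,
      ε * (deriv u x * deriv v x) - b x * deriv u x * v x + c x * u x * v x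
        = f x * v x + ε * (deriv (fun _ : ℝ => (1 : ℝ)) x * deriv u x * v x
          + 1 * deriv (deriv u) x * v x + 1 * deriv u x * deriv v x) := by
    refine ae_unitMeasure countable_empty fun x hx => ?_
    rw [deriv_const]
    linear_combination v x * hL x (Ioo_subset_Icc_self hx.1)
  rw [integral_congr_ae this, integral_add, integral_const_mul, hp, mul_zero, add_zero]
  · have hf : ContinuousOn f (Icc 0 1) := by
      have h1 : Continuous fun x => -ε * deriv (deriv u) x - b x * deriv u x + c x * u x := by
        have := (contDiff_deriv (n := 0) hu').continuous
        have := hu'.continuous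
        have := hu.continuous
        fun_prop
      exact h1.continuousOn.congr fun x hx => (hL x hx).symm
    exact ((essBdd_of_continuousOn hf).mul' hv.essBdd).integrable'
  · exact EssBdd.integrable' ((EssBdd.const ε).mul' hp')

/-- The square is at most `2 e^{-2δx/ε} + 2 ε²`, whose integral is elementary. The resulting order
`ε` is what absorbs the factor `1/ε` in the energy estimate. -/
lemma integral_layerWeight_sq_le {δ ε : ℝ} (hδ : 0 < δ) (hε : 0 < ε) :
    ∫ x, (layerWeight δ ε ε x) ^ 2 ∂unitMeasure ≤ ε / δ + 2 * ε ^ 2 := by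
  have hlam : 0 < 2 * δ / ε := by positivity
  set lam := 2 * δ / ε with hl
  have h1 : ∀ x, HasDerivAt (fun x : ℝ => -(2 / lam) * Real.exp (-lam * x) + 2 * ε ^ 2 * x)
      (2 * Real.exp (-lam * x) + 2 * ε ^ 2) x := by
    intro x
    have e1 : HasDerivAt (fun x : ℝ => -lam * x) (-lam) x := by
      simpa using (hasDerivAt_id x).const_mul (-lam)
    have e2 : HasDerivAt (fun x : ℝ => 2 * ε ^ 2 * x) (2 * ε ^ 2) x := by
      simpa using (hasDerivAt_id x).const_mul (2 * ε ^ 2)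
    refine ((e1.exp.const_mul (-(2 / lam))).add e2).congr_deriv ?_
    field_simp
  have hc : Continuous fun x : ℝ => 2 * Real.exp (-lam * x) + 2 * ε ^ 2 := by fun_prop
  have h2 : ∫ x in (0 : ℝ)..1, (2 * Real.exp (-lam * x) + 2 * ε ^ 2) ≤ ε / δ + 2 * ε ^ 2 := by
    rw [intervalIntegral.integral_eq_sub_of_hasDerivAt (fun x _ => h1 x)
      (hc.intervalIntegrable _ _)]
    have e1 : 2 / lam = ε / δ := by rw [hl]; field_simp
    have e2 : 0 < ε / δ * Real.exp (-lam * 1) := by positivity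
    simp only [e1, mul_zero, Real.exp_zero]
    linarith
  refine le_trans ?_ h2
  rw [integral_unit]
  refine integral_mono (essBdd_of_continuousOn ?_).integrable'
    (essBdd_of_continuousOn hc.continuousOn).integrable' fun x => ?_
  · unfold layerWeight
    fun_prop
  · have e1 : Real.exp (-lam * x) = Real.exp (-(δ * x / ε)) ^ 2 := by
      rw [← Real.exp_nat_mul]
      congr 1
      rw [hl]
      push_cast
      ring
    simp only [layerWeight, e1]
    nlinarith [sq_nonneg (Real.exp (-(δ * x / ε)) - ε)]

lemma neg_mul_le_young {x y a : ℝ} (ha : 0 < a) : -(x * y) ≤ a * y ^ 2 / 8 + 2 * x ^ 2 / a := by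
  have : a * y ^ 2 / 8 + 2 * x ^ 2 / a - -(x * y) = (a * y + 4 * x) ^ 2 / (8 * a) := by
    field_simp
    ring
  have h2 : 0 ≤ (a * y + 4 * x) ^ 2 / (8 * a) := by positivity
  linarith

/-- Integrand of the energy argument, with `P = χ'` and `q = χ`. The second and third groups are `(b
R χ)'` and `½ (b χ²)'`, which integrate to zero. They remove `R'` from the convection term and
produce `c + b'/2 ≥ γ`. Six applications of Young's inequality remain, three costing `ε P²/8` and
three `γ q²/8`, so half of the coercive part survives. -/
lemma energy_pointwise {ε γ D b b' c A A' R R' P q : ℝ} (hε : 0 < ε) (hε1 : ε ≤ 1) (hγ : 0 < γ)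
    (hb : |b| ≤ D) (hb' : |b'| ≤ D) (hc : |c| ≤ D) (hcb : γ ≤ c + 1 / 2 * b') :
    ε / 2 * P ^ 2 + γ / 2 * q ^ 2 ≤
      (ε * ((A' + R' + P) * P) - b * (A' + R' + P) * q + c * (A + R + q) * q)
      + (b' * R * q + b * R' * q + b * R * P) + 1 / 2 * (b' * q * q + b * P * q + b * q * P)
      + (2 + 2 * D ^ 2 + 8 * D ^ 2 / γ) * (A ^ 2 + A' ^ 2 + ε * R' ^ 2 + R ^ 2 / ε) := by
  have sq : ∀ {t : ℝ}, |t| ≤ D → t ^ 2 ≤ D ^ 2 := fun h => sq_le_sq' (abs_le.1 h).1 (abs_le.1 h).2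
  have y1 := neg_mul_le_young (x := ε * A') (y := P) hε
  have y2 := neg_mul_le_young (x := ε * R') (y := P) hε
  have y3 := neg_mul_le_young (x := b * R) (y := P) hε
  have y4 := neg_mul_le_young (x := -(b * A')) (y := q) hγ
  have y5 := neg_mul_le_young (x := (b' + c) * R) (y := q) hγ
  have y6 := neg_mul_le_young (x := c * A) (y := q) hγ
  have z1 : 2 * (ε * A') ^ 2 / ε ≤ 2 * A' ^ 2 := by
    rw [div_le_iff₀ hε]
    have e1 : ε * ε * A' ^ 2 ≤ ε * 1 * A' ^ 2 := by gcongr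
    linarith
  have z2 : 2 * (ε * R') ^ 2 / ε = 2 * (ε * R' ^ 2) := by field_simp
  have z3 : 2 * (b * R) ^ 2 / ε ≤ 2 * D ^ 2 * (R ^ 2 / ε) := by
    rw [mul_pow, ← mul_div_assoc]
    refine div_le_div_of_nonneg_right ?_ hε.le
    have e1 := mul_le_mul_of_nonneg_right (sq hb) (sq_nonneg R)
    linarith
  have z4 : 2 * (-(b * A')) ^ 2 / γ ≤ 8 * D ^ 2 / γ * A' ^ 2 := by
    rw [div_mul_eq_mul_div]
    refine div_le_div_of_nonneg_right ?_ hγ.le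
    have e1 := mul_le_mul_of_nonneg_right (sq hb) (sq_nonneg A')
    have e2 := mul_nonneg (sq_nonneg D) (sq_nonneg A')
    rw [neg_sq, mul_pow]
    linarith
  have z5 : 2 * ((b' + c) * R) ^ 2 / γ ≤ 8 * D ^ 2 / γ * (R ^ 2 / ε) := by
    have e1 : R ^ 2 ≤ R ^ 2 / ε := by
      rw [le_div_iff₀ hε]
      exact mul_le_of_le_one_right (sq_nonneg R) hε1
    have e2 : (b' + c) ^ 2 ≤ 4 * D ^ 2 := by linarith [sq hb', sq hc, sq_nonneg (b' - c)]
    have e3 : 2 * ((b' + c) * R) ^ 2 / γ ≤ 8 * D ^ 2 / γ * R ^ 2 := by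
      rw [div_mul_eq_mul_div]
      refine div_le_div_of_nonneg_right ?_ hγ.le
      have e4 := mul_le_mul_of_nonneg_right e2 (sq_nonneg R)
      rw [mul_pow]
      linarith
    exact e3.trans (mul_le_mul_of_nonneg_left e1 (by positivity))
  have z6 : 2 * (c * A) ^ 2 / γ ≤ 8 * D ^ 2 / γ * A ^ 2 := by
    rw [div_mul_eq_mul_div]
    refine div_le_div_of_nonneg_right ?_ hγ.le
    have e1 := mul_le_mul_of_nonneg_right (sq hc) (sq_nonneg A)
    have e2 := mul_nonneg (sq_nonneg D) (sq_nonneg A)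
    rw [mul_pow]
    linarith
  have z7 := mul_le_mul_of_nonneg_right hcb (sq_nonneg q)
  have p1 : 0 ≤ R ^ 2 / ε := by positivity
  have p2 : 0 ≤ ε * R' ^ 2 := by positivity
  have p3 : 0 ≤ (2 + 2 * D ^ 2) * A ^ 2 := by positivity
  have p4 : 0 ≤ 2 * D ^ 2 * A' ^ 2 := by positivity
  have p5 : 0 ≤ (2 * D ^ 2 + 8 * D ^ 2 / γ) * (ε * R' ^ 2) := by positivity
  have p6 : 0 ≤ 2 * (R ^ 2 / ε) := by positivity
  have p7 : 0 ≤ ε * P ^ 2 := by positivity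
  have p8 : 0 ≤ γ * q ^ 2 := by positivity
  linarith

/-- Abstract energy estimate: the error `e = A + R + χ` is controlled by pointwise bounds for the
approximation errors `A`, `R` if it is orthogonal to `χ`. -/
lemma exists_energyNorm_le {γ δ : ℝ} {b c : ℝ → ℝ} (hb : ContDiff ℝ 1 b) (hc : Continuous c)
    (hγ : 0 < γ) (hδ : 0 < δ) (hcb : ∀ x ∈ Icc (0 : ℝ) 1, γ ≤ c x + 1 / 2 * deriv b x) :
    ∃ K : ℝ, 0 ≤ K ∧ ∀ (ε Q : ℝ) (s : Set ℝ) (e A R χ : ℝ → ℝ), 0 < ε → ε ≤ 1 → 0 ≤ Q →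
      s.Countable → PiecewiseDiff s e → PiecewiseDiff s A → PiecewiseDiff s R →
      PiecewiseDiff s χ → (∀ x, e x = A x + R x + χ x) → χ 0 = 0 → χ 1 = 0 →
      bilin ε b c e χ = 0 →
      (∀ x ∈ Ioo (0 : ℝ) 1 \ s, |A x| ≤ Q ∧ |deriv A x| ≤ Q ∧ |R x| ≤ Q * layerWeight δ ε ε x ∧
        ε * |deriv R x| ≤ Q * layerWeight δ ε ε x) →
      energyNorm ε e ≤ K * Q := by
  obtain ⟨D₁, hD₁⟩ := isCompact_Icc.exists_bound_of_continuousOn (s := Icc (0 : ℝ) 1)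
    hb.continuous.continuousOn
  obtain ⟨D₂, hD₂⟩ := isCompact_Icc.exists_bound_of_continuousOn (s := Icc (0 : ℝ) 1)
    (contDiff_deriv (n := 0) hb).continuous.continuousOn
  obtain ⟨D₃, hD₃⟩ := isCompact_Icc.exists_bound_of_continuousOn (s := Icc (0 : ℝ) 1)
    hc.continuousOn
  set D := max D₁ (max D₂ D₃) with hDdef
  set α := min 1 γ with hα
  have hα0 : 0 < α := lt_min one_pos hγ
  set K₀ := 2 + 2 * D ^ 2 + 8 * D ^ 2 / γ with hK₀
  have hK₀0 : 0 ≤ K₀ := by positivity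
  set K₁ := 6 * K₀ / α + 3 with hK₁
  have hK₁0 : 0 ≤ K₁ := by positivity
  refine ⟨√(K₁ * (2 + 2 * (1 / δ + 2))), Real.sqrt_nonneg _, ?_⟩
  intro ε Q s e A R χ hε hε1 hQ hs he hA hR hχ hsum hχ0 hχ1 horth hbd
  -- `J` has integral zero: the first group by orthogonality, the others as exact derivatives. All
  -- estimates can therefore be made pointwise before integrating.
  set J : ℝ → ℝ := fun x =>
    (ε * (deriv e x * deriv χ x) - b x * deriv e x * χ x + c x * e x * χ x)
      + (deriv b x * R x * χ x + b x * deriv R x * χ x + b x * R x * deriv χ x)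
      + 1 / 2 * (deriv b x * χ x * χ x + b x * deriv χ x * χ x + b x * χ x * deriv χ x) with hJ
  have j1 := essBdd_bilin (ε := ε) hs hb.continuous hc he hχ
  have j2 := essBdd_parts hs hb hR hχ
  have j3 := (EssBdd.const (1 / 2)).mul' (essBdd_parts hs hb hχ hχ)
  have hJb : EssBdd J := (j1.add' j2).add' j3
  have hJ0 : ∫ x, J x ∂unitMeasure = 0 := by
    rw [hJ, integral_add (EssBdd.integrable' (j1.add' j2)) j3.integrable',
      integral_add j1.integrable' j2.integrable', integral_const_mul,
      integral_mul_mul_deriv_eq_zero hs hb hR hχ hχ0 hχ1,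
      integral_mul_mul_deriv_eq_zero hs hb hχ hχ hχ0 hχ1,
      ← bilin_eq hs hb.continuous hc he hχ, horth]
    simp
  have hW : EssBdd fun x => layerWeight δ ε ε x ^ 2 := by
    refine essBdd_of_continuousOn ?_
    unfold layerWeight
    fun_prop
  have hpt : ∀ x ∈ Ioo (0 : ℝ) 1 \ s, ε * deriv e x ^ 2 + e x ^ 2 ≤
      6 / α * J x + K₁ * (Q ^ 2 * (2 + 2 / ε * layerWeight δ ε ε x ^ 2)) := by
    intro x hx
    have hxI := Ioo_subset_Icc_self hx.1
    obtain ⟨a1, a2, a3, a4⟩ := hbd x hx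
    have hde : deriv e x = deriv A x + deriv R x + deriv χ x := by
      have h1 : e = fun x => A x + R x + χ x := funext hsum
      rw [h1]
      exact (((hA.differentiableAt x hx).hasDerivAt.add (hR.differentiableAt x hx).hasDerivAt).add
        (hχ.differentiableAt x hx).hasDerivAt).deriv
    have hpw := energy_pointwise (A := A x) (A' := deriv A x) (R := R x) (R' := deriv R x)
      (P := deriv χ x) (q := χ x) hε hε1 hγ ((hD₁ x hxI).trans (le_max_left _ _))
      ((hD₂ x hxI).trans ((le_max_left _ _).trans (le_max_right D₁ _)))
      ((hD₃ x hxI).trans ((le_max_right _ _).trans (le_max_right D₁ _))) (hcb x hxI)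
    rw [← hde, ← hsum x] at hpw
    change _ ≤ J x + K₀ * _ at hpw
    set W := layerWeight δ ε ε x with hWdef
    set T := A x ^ 2 + deriv A x ^ 2 + ε * deriv R x ^ 2 + R x ^ 2 / ε with hT
    have hT1 : T ≤ Q ^ 2 * (2 + 2 / ε * W ^ 2) := by
      have e1 : A x ^ 2 ≤ Q ^ 2 := sq_le_sq' (abs_le.1 a1).1 (abs_le.1 a1).2
      have e2 : deriv A x ^ 2 ≤ Q ^ 2 := sq_le_sq' (abs_le.1 a2).1 (abs_le.1 a2).2
      have e3 : R x ^ 2 ≤ (Q * W) ^ 2 := sq_le_sq' (abs_le.1 a3).1 (abs_le.1 a3).2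
      have e4 : (ε * deriv R x) ^ 2 ≤ (Q * W) ^ 2 := by
        have : |ε * deriv R x| ≤ Q * W := by rwa [abs_mul, abs_of_pos hε]
        exact sq_le_sq' (abs_le.1 this).1 (abs_le.1 this).2
      have e5 : ε * deriv R x ^ 2 = (ε * deriv R x) ^ 2 / ε := by field_simp
      have e6 := div_le_div_of_nonneg_right e3 hε.le
      have e7 := div_le_div_of_nonneg_right e4 hε.le
      have e8 : Q ^ 2 * (2 + 2 / ε * W ^ 2) = Q ^ 2 + Q ^ 2 + (Q * W) ^ 2 / ε + (Q * W) ^ 2 / ε := by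
        field_simp
        ring
      rw [hT, e5, e8]
      linarith
    have hE : ε * deriv e x ^ 2 + e x ^ 2 ≤ 3 * (ε * deriv χ x ^ 2 + χ x ^ 2) + 3 * T := by
      have q3 : ∀ p q r : ℝ, (p + q + r) ^ 2 ≤ 3 * (p ^ 2 + q ^ 2 + r ^ 2) := fun p q r => by
        nlinarith [sq_nonneg (p - q), sq_nonneg (p - r), sq_nonneg (q - r)]
      have e1 := mul_le_mul_of_nonneg_left (q3 (deriv A x) (deriv R x) (deriv χ x)) hε.le
      have e2 := q3 (A x) (R x) (χ x)
      have e3 : ε * deriv A x ^ 2 ≤ deriv A x ^ 2 := mul_le_of_le_one_left (sq_nonneg _) hε1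
      have e4 : R x ^ 2 ≤ R x ^ 2 / ε := by
        rw [le_div_iff₀ hε]
        exact mul_le_of_le_one_right (sq_nonneg _) hε1
      rw [hde, hsum x, hT]
      linarith
    have hχE : α * (ε * deriv χ x ^ 2 + χ x ^ 2) ≤ 2 * (J x + K₀ * T) := by
      have e1 : α * (ε * deriv χ x ^ 2) ≤ ε * deriv χ x ^ 2 :=
        mul_le_of_le_one_left (by positivity) (min_le_left _ _)
      have e2 : α * χ x ^ 2 ≤ γ * χ x ^ 2 :=
        mul_le_mul_of_nonneg_right (min_le_right _ _) (sq_nonneg _)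
      linarith
    have hχE2 : ε * deriv χ x ^ 2 + χ x ^ 2 ≤ 2 * (J x + K₀ * T) / α := by
      rw [le_div_iff₀ hα0]
      linarith
    calc ε * deriv e x ^ 2 + e x ^ 2 ≤ 3 * (2 * (J x + K₀ * T) / α) + 3 * T := by linarith
      _ = 6 / α * J x + K₁ * T := by rw [hK₁]; ring
      _ ≤ _ := by
        have := mul_le_mul_of_nonneg_left hT1 hK₁0
        linarith
  have hWi : EssBdd fun x => K₁ * (Q ^ 2 * (2 + 2 / ε * layerWeight δ ε ε x ^ 2)) :=
    (EssBdd.const _).mul' ((EssBdd.const _).mul'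
      ((EssBdd.const 2).add' ((EssBdd.const (2 / ε)).mul' hW)))
  have hJi : EssBdd fun x => 6 / α * J x := (EssBdd.const _).mul' hJb
  have hμ : ∫ _x, (2 : ℝ) ∂unitMeasure = 2 := by
    rw [← integral_unit]
    simp
  have hfin : ∫ x, (ε * deriv e x ^ 2 + e x ^ 2) ∂unitMeasure ≤
      K₁ * (2 + 2 * (1 / δ + 2)) * Q ^ 2 := by
    refine (integral_mono_ae (essBdd_energy hs he).integrable'
      (EssBdd.integrable' (hJi.add' hWi)) (ae_unitMeasure hs hpt)).trans ?_
    rw [integral_add hJi.integrable' hWi.integrable', integral_const_mul, hJ0, integral_const_mul,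
      integral_const_mul, integral_add (EssBdd.const 2).integrable'
        ((EssBdd.const (2 / ε)).mul' hW).integrable', integral_const_mul, hμ]
    have h1 := integral_layerWeight_sq_le hδ hε
    -- Here `1/ε` meets the `O(ε)` bound for the squared weight, and the constant becomes
    -- independent of `ε`.
    have h2 : 2 / ε * ∫ x, layerWeight δ ε ε x ^ 2 ∂unitMeasure ≤ 2 * (1 / δ + 2) := by
      refine (mul_le_mul_of_nonneg_left h1 (by positivity)).trans ?_
      have : 2 / ε * (ε / δ + 2 * ε ^ 2) = 2 * (1 / δ + 2 * ε) := by field_simp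
      rw [this]
      linarith
    have h3 : 0 ≤ K₁ * Q ^ 2 := by positivity
    have h4 := mul_le_mul_of_nonneg_left h2 h3
    linarith
  rw [energyNorm_sq_eq hs he]
  refine (Real.sqrt_le_sqrt hfin).trans ?_
  rw [Real.sqrt_mul (by positivity), Real.sqrt_sq hQ]

/-- Energy stability: two weak solutions tested with themselves differ by a bounded amount. -/
lemma exists_energyNorm_sub_le {γ : ℝ} {b c f : ℝ → ℝ} (hb : ContDiff ℝ 1 b) (hc : Continuous c)
    (hf : Continuous f) (hγ : 0 < γ)
    (hcb : ∀ x ∈ Icc (0 : ℝ) 1, γ ≤ c x + 1 / 2 * deriv b x) :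
    ∃ K : ℝ, 0 ≤ K ∧ ∀ (ε : ℝ) (s : Set ℝ) (v w : ℝ → ℝ), 0 < ε → s.Countable →
      PiecewiseDiff s v → PiecewiseDiff s w → v 0 = 0 → v 1 = 0 → w 0 = 0 → w 1 = 0 →
      bilin ε b c v v = ∫ x in (0 : ℝ)..1, f x * v x →
      bilin ε b c w w = ∫ x in (0 : ℝ)..1, f x * w x →
      energyNorm ε (fun x => v x - w x) ≤ K := by
  set α := min 1 (γ / 2) with hα
  have hα0 : 0 < α := lt_min one_pos (half_pos hγ)
  set F : ℝ := ∫ x, 2 / α * (f x ^ 2 / γ) ∂unitMeasure with hF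
  refine ⟨√F, Real.sqrt_nonneg _, ?_⟩
  intro ε s v w hε hs hv hw hv0 hv1 hw0 hw1 hav haw
  have hfb := essBdd_of_continuousOn hf.continuousOn (F := f)
  -- Each function is bounded separately by testing with itself. Adding the exact derivative `½ (b
  -- v²)'` gives coercivity, and Young's inequality absorbs `f v`.
  have key : ∀ v : ℝ → ℝ, PiecewiseDiff s v → v 0 = 0 → v 1 = 0 →
      bilin ε b c v v = ∫ x in (0 : ℝ)..1, f x * v x → ∃ J : ℝ → ℝ, EssBdd J ∧
      ∫ x, J x ∂unitMeasure = 0 ∧ ∀ x ∈ Ioo (0 : ℝ) 1 \ s,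
        α * (ε * deriv v x ^ 2 + v x ^ 2) ≤ J x + f x ^ 2 / γ / 2 := by
    intro v hv hv0 hv1 hav
    have j1 := essBdd_bilin (ε := ε) hs hb.continuous hc hv hv
    have j2 := (EssBdd.const (1 / 2)).mul' (essBdd_parts hs hb hv hv)
    have j3 := hfb.mul' hv.essBdd
    refine ⟨_, (j1.add' j2).sub' j3, ?_, ?_⟩
    · rw [integral_sub (EssBdd.integrable' (j1.add' j2)) j3.integrable',
        integral_add j1.integrable' j2.integrable', integral_const_mul,
        integral_mul_mul_deriv_eq_zero hs hb hv hv hv0 hv1,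
        ← bilin_eq hs hb.continuous hc hv hv, hav, integral_unit]
      simp
    · intro x hx
      have h1 := mul_le_mul_of_nonneg_right (hcb x (Ioo_subset_Icc_self hx.1)) (sq_nonneg (v x))
      have h2 : f x * v x ≤ γ / 2 * v x ^ 2 + f x ^ 2 / γ / 2 := by
        have : γ / 2 * v x ^ 2 + f x ^ 2 / γ / 2 - f x * v x = (γ * v x - f x) ^ 2 / (2 * γ) := by
          field_simp
          ring
        have h3 : 0 ≤ (γ * v x - f x) ^ 2 / (2 * γ) := by positivity
        linarith
      have e1 : α * (ε * deriv v x ^ 2) ≤ ε * deriv v x ^ 2 :=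
        mul_le_of_le_one_left (by positivity) (min_le_left _ _)
      have e2 : α * v x ^ 2 ≤ γ / 2 * v x ^ 2 :=
        mul_le_mul_of_nonneg_right (min_le_right _ _) (sq_nonneg _)
      linarith
  obtain ⟨J₁, hJ₁, hJ₁0, hJ₁b⟩ := key v hv hv0 hv1 hav
  obtain ⟨J₂, hJ₂, hJ₂0, hJ₂b⟩ := key w hw hw0 hw1 haw
  have hvw := hv.sub hw
  have hi1 : EssBdd fun x => 2 / α * (J₁ x + J₂ x) := (EssBdd.const _).mul' (hJ₁.add' hJ₂)
  have hi2 : EssBdd fun x => 2 / α * (f x ^ 2 / γ) :=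
    essBdd_of_continuousOn (by fun_prop)
  rw [energyNorm_sq_eq hs hvw]
  refine Real.sqrt_le_sqrt ((integral_mono_ae (essBdd_energy hs hvw).integrable'
    (EssBdd.integrable' (hi1.add' hi2)) (ae_unitMeasure hs fun x hx => ?_)).trans ?_)
  · have h1 := hJ₁b x hx
    have h2 := hJ₂b x hx
    have h3 : ε * deriv v x ^ 2 + v x ^ 2 + (ε * deriv w x ^ 2 + w x ^ 2) ≤
        (J₁ x + J₂ x + f x ^ 2 / γ) / α := by
      rw [le_div_iff₀ hα0]
      linarith
    have h4 : deriv (fun x => v x - w x) x = deriv v x - deriv w x :=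
      deriv_fun_sub (hv.differentiableAt x hx) (hw.differentiableAt x hx)
    simp only [h4]
    have h5 : 2 / α * (J₁ x + J₂ x) + 2 / α * (f x ^ 2 / γ)
        = 2 * ((J₁ x + J₂ x + f x ^ 2 / γ) / α) := by ring
    rw [h5]
    nlinarith [sq_nonneg (v x + w x), mul_nonneg hε.le (sq_nonneg (deriv v x + deriv w x))]
  · rw [integral_add hi1.integrable' hi2.integrable', integral_const_mul,
      integral_add hJ₁.integrable' hJ₂.integrable', hJ₁0, hJ₂0]
    simp [hF]

end BakhvalovFEM

namespace BakhvalovFEM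

/-! ### Piecewise polynomial approximation -/

lemma exists_polynomial_derivative_eq {k : ℕ} (q : Polynomial ℝ) (hq : q.natDegree ≤ k) :
    ∃ p : Polynomial ℝ, p.natDegree ≤ k + 1 ∧ p.derivative = q := by
  refine ⟨∑ i ∈ Finset.range (k + 1), Polynomial.monomial (i + 1) (q.coeff i / (i + 1)), ?_, ?_⟩
  · refine Polynomial.natDegree_sum_le_of_forall_le _ _ fun i hi => ?_
    exact (Polynomial.natDegree_monomial_le _).trans (by have := Finset.mem_range.1 hi; omega)
  · rw [Polynomial.derivative_sum]
    conv_rhs => rw [q.as_sum_range' (k + 1) (by omega)]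
    refine Finset.sum_congr rfl fun i _ => ?_
    rw [Polynomial.derivative_monomial]
    congr 1
    push_cast
    field_simp

/-- Taylor approximation in `C^1`. -/
lemma exists_taylor_polynomial (k : ℕ) : ∀ (w : ℝ → ℝ) (a h K : ℝ), ContDiff ℝ (k + 1 : ℕ) w →
    0 ≤ h → (∀ x ∈ Icc a (a + h), |iteratedDeriv (k + 1) w x| ≤ K) →
    ∃ p : Polynomial ℝ, p.natDegree ≤ k ∧ ∀ x ∈ Icc a (a + h),
      |w x - p.eval x| ≤ K * h ^ (k + 1) ∧ |deriv w x - p.derivative.eval x| ≤ K * h ^ k := by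
  -- A bound for the derivative error, together with agreement at the left end point, gives the
  -- value bound. The induction integrates the polynomial found for `w'`.
  have step : ∀ (w : ℝ → ℝ) (p : Polynomial ℝ) (a h M : ℝ), ContDiff ℝ 1 w → 0 ≤ h →
      w a = p.eval a → (∀ x ∈ Icc a (a + h), |deriv w x - p.derivative.eval x| ≤ M) →
      ∀ x ∈ Icc a (a + h), |w x - p.eval x| ≤ M * h := by
    intro w p a h M hw hh ha hM x hx
    have hM0 : 0 ≤ M := (abs_nonneg _).trans (hM x hx)
    have h1 := (convex_Icc a (a + h)).norm_image_sub_le_of_norm_hasDerivWithin_le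
      (f := fun y => w y - p.eval y) (f' := fun y => deriv w y - p.derivative.eval y)
      (fun y _ => ((hw.differentiable (by simp) y).hasDerivAt.sub (p.hasDerivAt y)).hasDerivWithinAt)
      hM (left_mem_Icc.2 (by linarith)) hx
    rw [ha, sub_self, sub_zero, Real.norm_eq_abs, Real.norm_eq_abs] at h1
    refine h1.trans (mul_le_mul_of_nonneg_left ?_ hM0)
    rw [abs_le]
    constructor <;> linarith [hx.1, hx.2]
  induction k with
  | zero =>
    intro w a h K hw hh hK
    have hd : ∀ x ∈ Icc a (a + h), |deriv w x - (Polynomial.C (w a)).derivative.eval x| ≤ K := by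
      intro x hx
      have := hK x hx
      rw [zero_add, iteratedDeriv_one] at this
      simpa using this
    refine ⟨Polynomial.C (w a), by simp, fun x hx => ⟨?_, ?_⟩⟩
    · simpa using step w (Polynomial.C (w a)) a h K hw hh (by simp) hd x hx
    · simpa using hd x hx
  | succ k ih =>
    intro w a h K hw hh hK
    obtain ⟨q, hq, hqb⟩ := ih (deriv w) a h K (contDiff_deriv hw) hh (fun x hx => by
      rw [← iteratedDeriv_succ']
      exact hK x hx)
    obtain ⟨p₀, hp₀, hp₀d⟩ := exists_polynomial_derivative_eq q hq
    set p := p₀ + Polynomial.C (w a - p₀.eval a) with hp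
    have hpd : p.derivative = q := by simp [hp, hp₀d]
    have hd : ∀ x ∈ Icc a (a + h), |deriv w x - p.derivative.eval x| ≤ K * h ^ (k + 1) := by
      intro x hx
      rw [hpd]
      exact (hqb x hx).1
    refine ⟨p, ?_, fun x hx => ⟨?_, hd x hx⟩⟩
    · exact (Polynomial.natDegree_add_le _ _).trans (max_le hp₀ (by simp))
    · have := step w p a h _ (contDiff_of_le (n := 1) hw (by omega)) hh (by simp [hp]) hd x hx
      rwa [mul_assoc, ← pow_succ] at this

/-- Polynomial approximation with prescribed values at the end points. -/
lemma exists_polynomial_with_endpoints {k : ℕ} (hk : 1 ≤ k) {w : ℝ → ℝ} {a b K M y z : ℝ}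
    (hw : ContDiff ℝ (k + 1 : ℕ) w) (hab : a < b)
    (hK : ∀ x ∈ Icc a b, |iteratedDeriv (k + 1) w x| ≤ K) (hy : |w a - y| ≤ M) (hz : |w b - z| ≤ M) :
    ∃ p : Polynomial ℝ, p.natDegree ≤ k ∧ p.eval a = y ∧ p.eval b = z ∧ ∀ x ∈ Icc a b,
      |w x - p.eval x| ≤ 3 * (K * (b - a) ^ (k + 1)) + 2 * M ∧
      (b - a) * |deriv w x - p.derivative.eval x| ≤ 3 * (K * (b - a) ^ (k + 1)) + 2 * M := by
  have hba : 0 < b - a := sub_pos.2 hab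
  obtain ⟨q, hq, hqb⟩ := exists_taylor_polynomial k w a (b - a) K hw hba.le (by simpa using hK)
  rw [add_sub_cancel] at hqb
  set α := (y - q.eval a) / (b - a) with hα
  set β := (z - q.eval b) / (b - a) with hβ
  set E := K * (b - a) ^ (k + 1) with hE
  have hα' : α * (b - a) = y - q.eval a := div_mul_cancel₀ _ hba.ne'
  have hβ' : β * (b - a) = z - q.eval b := div_mul_cancel₀ _ hba.ne'
  have e1 : |y - q.eval a| ≤ E + M := by
    have h1 := (hqb a (left_mem_Icc.2 hab.le)).1
    rw [abs_le] at h1 hy ⊢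
    constructor <;> linarith [h1.1, h1.2, hy.1, hy.2]
  have e2 : |z - q.eval b| ≤ E + M := by
    have h1 := (hqb b (right_mem_Icc.2 hab.le)).1
    rw [abs_le] at h1 hz ⊢
    constructor <;> linarith [h1.1, h1.2, hz.1, hz.2]
  -- The Taylor polynomial plus the affine function matching the two end point defects, each at most
  -- `E + M`. The affine term is where `1 ≤ k` is needed. `M` permits end point values different
  -- from those of `w`.
  refine ⟨q + (Polynomial.C α * (Polynomial.C b - Polynomial.X)
    + Polynomial.C β * (Polynomial.X - Polynomial.C a)), ?_, ?_, ?_, fun x hx => ⟨?_, ?_⟩⟩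
  · refine (Polynomial.natDegree_add_le _ _).trans (max_le hq ?_)
    refine ((Polynomial.natDegree_add_le _ _).trans (max_le ?_ ?_)).trans hk
    · refine (Polynomial.natDegree_C_mul_le _ _).trans ?_
      exact (Polynomial.natDegree_sub_le _ _).trans (by simp)
    · refine (Polynomial.natDegree_C_mul_le _ _).trans ?_
      exact (Polynomial.natDegree_sub_le _ _).trans (by simp)
  · simp [hα']
  · simp [hβ']
  · simp only [Polynomial.eval_add, Polynomial.eval_mul, Polynomial.eval_C, Polynomial.eval_sub,
      Polynomial.eval_X]
    have h1 := (hqb x hx).1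
    set t := (x - a) / (b - a) with ht
    have ht0 : 0 ≤ t := div_nonneg (by linarith [hx.1]) hba.le
    have ht1 : t ≤ 1 := (div_le_one hba).2 (by linarith [hx.2])
    have hta : t * (b - a) = x - a := div_mul_cancel₀ _ hba.ne'
    have h2 : α * (b - x) = (1 - t) * (y - q.eval a) := by
      rw [← hα']
      linear_combination α * hta
    have h3 : β * (x - a) = t * (z - q.eval b) := by
      rw [← hβ', ← hta]
      ring
    have hEM : 0 ≤ E + M := (abs_nonneg _).trans e1
    rw [h2, h3]
    have h4 : |(1 - t) * (y - q.eval a)| ≤ E + M := by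
      rw [abs_mul, abs_of_nonneg (by linarith)]
      exact (mul_le_of_le_one_left (abs_nonneg _) (by linarith)).trans e1
    have h5 : |t * (z - q.eval b)| ≤ E + M := by
      rw [abs_mul, abs_of_nonneg ht0]
      exact (mul_le_of_le_one_left (abs_nonneg _) ht1).trans e2
    rw [abs_le] at h1 h4 h5 ⊢
    constructor <;> linarith [h1.1, h1.2, h4.1, h4.2, h5.1, h5.2]
  · have h1 := mul_le_mul_of_nonneg_left (hqb x hx).2 hba.le
    have h2 : (b - a) * (K * (b - a) ^ k) = E := by rw [hE]; ring
    rw [h2] at h1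
    have h3 : (b - a) * |deriv w x - (q + (Polynomial.C α * (Polynomial.C b - Polynomial.X)
        + Polynomial.C β * (Polynomial.X - Polynomial.C a))).derivative.eval x|
        = |(b - a) * (deriv w x - q.derivative.eval x) + (y - q.eval a) - (z - q.eval b)| := by
      rw [← abs_of_pos hba, ← abs_mul, abs_of_pos hba, ← hα', ← hβ']
      congr 1
      simp
      ring
    rw [h3]
    have h4 : |(b - a) * (deriv w x - q.derivative.eval x)| ≤ E := by
      rwa [abs_mul, abs_of_pos hba]
    rw [abs_le] at h4 e1 e2 ⊢
    constructor <;> linarith [h4.1, h4.2, e1.1, e1.2, e2.1, e2.2]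

/-- A mesh `0 = x 0 < x 1 < ... < x N = 1`. -/
structure IsMesh (N : ℕ) (x : ℕ → ℝ) : Prop where
  zero : x 0 = 0
  last : x N = 1
  lt : ∀ i < N, x i < x (i + 1)

lemma exists_continuous_glue (x : ℕ → ℝ) (p : ℕ → Polynomial ℝ) (y : ℕ → ℝ) (N : ℕ) :
    (∀ i < N, x i < x (i + 1)) → (∀ i < N, (p i).eval (x i) = y i) →
    (∀ i < N, (p i).eval (x (i + 1)) = y (i + 1)) →
    ∃ w : ℝ → ℝ, Continuous w ∧ w (x N) = y N ∧
      ∀ i < N, x (i + 1) ≤ x N ∧ ∀ t ∈ Icc (x i) (x (i + 1)), w t = (p i).eval t := by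
  induction N with
  | zero =>
    intro _ _ _
    exact ⟨fun _ => y 0, continuous_const, rfl, fun i hi => absurd hi (by omega)⟩
  | succ N ih =>
    intro hx hl hr
    obtain ⟨w, hw, hwN, hwp⟩ := ih (fun i hi => hx i (by omega)) (fun i hi => hl i (by omega))
      (fun i hi => hr i (by omega))
    have hN := hx N (by omega)
    refine ⟨fun t => if t ≤ x N then w t else (p N).eval t, ?_, ?_, ?_⟩
    · refine Continuous.if_le hw (p N).continuous continuous_id continuous_const ?_
      rintro t rfl
      rw [hwN, hl N (by omega)]
    · beta_reduce
      rw [if_neg (by linarith)]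
      exact hr N (by omega)
    · intro i hi
      rcases Nat.lt_or_ge i N with h | h
      · obtain ⟨h1, h2⟩ := hwp i h
        refine ⟨h1.trans hN.le, fun t ht => ?_⟩
        beta_reduce
        rw [if_pos (ht.2.trans h1)]
        exact h2 t ht
      · obtain rfl : i = N := by omega
        refine ⟨le_rfl, fun t ht => ?_⟩
        beta_reduce
        rcases eq_or_lt_of_le ht.1 with h' | h'
        · rw [if_pos h'.symm.le, ← h', hwN, hl i (by omega)]
        · rw [if_neg (not_le.2 h')]

/-- The set of mesh points. -/
def meshSet (N : ℕ) (x : ℕ → ℝ) : Set ℝ := x '' Iic N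

lemma countable_meshSet (N : ℕ) (x : ℕ → ℝ) : (meshSet N x).Countable :=
  ((finite_Iic N).image x).countable

lemma IsMesh.exists_mem_Ioo {N : ℕ} {x : ℕ → ℝ} (hx : IsMesh N x) {t : ℝ}
    (ht : t ∈ Ioo (0 : ℝ) 1 \ meshSet N x) : ∃ i < N, t ∈ Ioo (x i) (x (i + 1)) := by
  have key : ∀ n ≤ N, t < x n → ∃ i < n, t ∈ Ioo (x i) (x (i + 1)) := by
    intro n
    induction n with
    | zero =>
      intro _ h
      rw [hx.zero] at h
      exact absurd ht.1.1 (not_lt.2 h.le)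
    | succ n ih =>
      intro hn h
      rcases lt_trichotomy t (x n) with h' | h' | h'
      · obtain ⟨i, hi, hi'⟩ := ih (by omega) h'
        exact ⟨i, by omega, hi'⟩
      · exact absurd ⟨n, by simp; omega, h'.symm⟩ ht.2
      · exact ⟨n, by omega, h', h⟩
  exact key N le_rfl (by rw [hx.last]; exact ht.1.2)

lemma IsMesh.le {N : ℕ} {x : ℕ → ℝ} (hx : IsMesh N x) {i j : ℕ} (hij : i ≤ j) (hj : j ≤ N) :
    x i ≤ x j := by
  induction j, hij using Nat.le_induction with
  | base => exact le_rfl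
  | succ j _ ih => exact (ih (by omega)).trans (hx.lt j (by omega)).le

lemma hasDerivAt_of_eqOn_polynomial {w : ℝ → ℝ} {p : Polynomial ℝ} {a b t : ℝ}
    (h : ∀ t ∈ Icc a b, w t = p.eval t) (ht : t ∈ Ioo a b) :
    HasDerivAt w (p.derivative.eval t) t := by
  refine (p.hasDerivAt t).congr_of_eventuallyEq ?_
  filter_upwards [Ioo_mem_nhds ht.1 ht.2] with y hy using h y (Ioo_subset_Icc_self hy)

lemma IsMesh.piecewiseDiff {N : ℕ} {x : ℕ → ℝ} {w : ℝ → ℝ} (hx : IsMesh N x)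
    (hw : ContinuousOn w (Icc 0 1))
    (hp : ∀ i < N, ∃ p : Polynomial ℝ, ∀ t ∈ Icc (x i) (x (i + 1)), w t = p.eval t) :
    PiecewiseDiff (meshSet N x) w := by
  choose! p hp using hp
  have hb : ∀ i, ∃ K, ∀ t ∈ Icc (x i) (x (i + 1)), |(p i).derivative.eval t| ≤ K := fun i =>
    isCompact_Icc.exists_bound_of_continuousOn (p i).derivative.continuous.continuousOn
  choose K hK using hb
  refine ⟨hw, fun t ht => ?_, ∑ i ∈ Finset.range N, |K i|, fun t ht => ?_⟩
  · obtain ⟨i, hi, hti⟩ := hx.exists_mem_Ioo ht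
    exact (hasDerivAt_of_eqOn_polynomial (hp i hi) hti).differentiableAt
  · obtain ⟨i, hi, hti⟩ := hx.exists_mem_Ioo ht
    rw [(hasDerivAt_of_eqOn_polynomial (hp i hi) hti).deriv]
    exact ((hK i t (Ioo_subset_Icc_self hti)).trans (le_abs_self _)).trans
      (Finset.single_le_sum (f := fun i => |K i|) (fun _ _ => abs_nonneg _)
        (Finset.mem_range.2 hi))

lemma IsMesh.piecewiseDiff_of_mem_femSpace {k N : ℕ} {x : ℕ → ℝ} {w : ℝ → ℝ} (hx : IsMesh N x)
    (hw : w ∈ femSpace k N x) : PiecewiseDiff (meshSet N x) w :=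
  hx.piecewiseDiff hw.1 fun i hi => (hw.2.2.2 i hi).imp fun _ h => h.2

/-- Piecewise polynomial approximation with prescribed nodal values and local error bounds. -/
lemma IsMesh.exists_approximation {k N : ℕ} {x : ℕ → ℝ} {w : ℝ → ℝ} {y : ℕ → ℝ} {F G : ℝ → ℝ}
    (hx : IsMesh N x)
    (h : ∀ i < N, ∃ p : Polynomial ℝ, p.natDegree ≤ k ∧ p.eval (x i) = y i ∧
      p.eval (x (i + 1)) = y (i + 1) ∧ ∀ t ∈ Icc (x i) (x (i + 1)),
        |w t - p.eval t| ≤ F t ∧ |deriv w t - p.derivative.eval t| ≤ G t)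
    (hw : ContDiff ℝ 1 w) (hN : 0 < N) :
    ∃ W : ℝ → ℝ, Continuous W ∧ W 0 = y 0 ∧ W 1 = y N ∧
      (∀ i < N, ∃ p : Polynomial ℝ, p.natDegree ≤ k ∧ ∀ t ∈ Icc (x i) (x (i + 1)),
        W t = p.eval t) ∧
      ∀ t ∈ Ioo (0 : ℝ) 1 \ meshSet N x,
        |w t - W t| ≤ F t ∧ |deriv (fun t => w t - W t) t| ≤ G t := by
  choose! p hp using h
  obtain ⟨W, hWc, hWN, hW⟩ := exists_continuous_glue x p y N hx.lt (fun i hi => (hp i hi).2.1)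
    (fun i hi => (hp i hi).2.2.1)
  refine ⟨W, hWc, ?_, ?_, fun i hi => ⟨p i, (hp i hi).1, (hW i hi).2⟩, fun t ht => ?_⟩
  · rw [← hx.zero, (hW 0 hN).2 (x 0) (left_mem_Icc.2 (hx.lt 0 hN).le), (hp 0 hN).2.1]
  · rw [← hx.last, hWN]
  · obtain ⟨i, hi, hti⟩ := hx.exists_mem_Ioo ht
    have hti' := Ioo_subset_Icc_self hti
    have hd := (hw.differentiable (by simp) t).hasDerivAt.fun_sub
      (hasDerivAt_of_eqOn_polynomial (hW i hi).2 hti)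
    rw [hd.deriv, (hW i hi).2 t hti']
    exact (hp i hi).2.2.2 t hti'

end BakhvalovFEM

namespace BakhvalovFEM

/-! ### Approximation on Bakhvalov-type meshes -/

/-- A Bakhvalov-type mesh with `N = 2 (n + 1)` intervals, logarithmically graded up to `x n`. -/
structure IsBakhvalovMesh (σ ε H : ℝ) (n : ℕ) (x : ℕ → ℝ) : Prop
    extends IsMesh (2 * (n + 1)) x where
  -- Holds for all intervals, the transition interval `[x n, x (n+1)]` included. It suffices for the
  -- smooth part.
  width : ∀ i < 2 * (n + 1), x (i + 1) - x i ≤ H / (2 * (n + 1) : ℕ)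
  -- `q = 2(1 - ε)` for Roos' mesh and `q = 2` for Kopteva's. The bound `3/N` places `x n` at least
  -- at `σ ε ln(N/3)`.
  graded : ∃ q : ℝ, 1 ≤ q ∧ q ≤ 2 ∧
    1 - q * ((n : ℝ) / (2 * (n + 1) : ℕ)) ≤ 3 / (2 * (n + 1) : ℕ) ∧
    ∀ i ≤ n, x i = -σ * ε * Real.log (1 - q * ((i : ℝ) / (2 * (n + 1) : ℕ)))

variable {σ ε H : ℝ} {n : ℕ} {x : ℕ → ℝ}

/-- Stopping the grading at index `n = N/2 - 1` keeps the argument of the logarithm away from zero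
by one step of size `2/N`. -/
lemma two_div_le_grading {q : ℝ} (hq2 : q ≤ 2) {i : ℕ} (hi : i ≤ n) :
    2 / ((2 * (n + 1) : ℕ) : ℝ) ≤ 1 - q * (i / (2 * (n + 1) : ℕ)) := by
  have hi' : (i : ℝ) ≤ n := by exact_mod_cast hi
  have hN : (0 : ℝ) < ((2 * (n + 1) : ℕ) : ℝ) := by positivity
  have h1 : q * ((i : ℝ) / (2 * (n + 1) : ℕ)) ≤ 2 * (n / (2 * (n + 1) : ℕ)) :=
    mul_le_mul hq2 (div_le_div_of_nonneg_right hi' hN.le) (by positivity) (by norm_num)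
  have h2 : 2 / ((2 * (n + 1) : ℕ) : ℝ) + 2 * (n / (2 * (n + 1) : ℕ)) = 1 := by
    push_cast
    field_simp
    ring
  linarith

/-- With `X_i = 1 - q i/N` the width is `σ ε ln(X_i/X_{i+1})`, and `e^{x_i/(σε)} = 1/X_i`. The lower
bound for the last graded interval is needed because the layer approximant is brought down to zero
there, which divides by that width. It follows from `X_{n-1} ≤ 3/N + 2/N` and `q ≥ 1`. -/
lemma IsBakhvalovMesh.graded_width (hx : IsBakhvalovMesh σ ε H n x) (hσ : 0 < σ) (hε : 0 < ε)
    {i : ℕ} (hi : i < n) : x (i + 1) - x i ≤ σ * ε ∧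
      (x (i + 1) - x i) / ε ≤ 2 * σ / (2 * (n + 1) : ℕ) * Real.exp (x (i + 1) / (σ * ε)) ∧
      (i + 1 = n → σ * ε / 5 ≤ x (i + 1) - x i) := by
  obtain ⟨q, hq1, hq2, hqn, hxq⟩ := hx.graded
  have hN : (0 : ℝ) < ((2 * (n + 1) : ℕ) : ℝ) := by positivity
  have hX1 := two_div_le_grading (n := n) hq2 (i := i + 1) (by omega)
  have hX0 := two_div_le_grading (n := n) hq2 (i := i) (by omega)
  have hxi := hxq i (by omega)
  have hxi1 := hxq (i + 1) (by omega)
  set N : ℝ := ((2 * (n + 1) : ℕ) : ℝ) with hNdef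
  set X₁ := 1 - q * ((i + 1 : ℕ) / N) with hX₁
  set X₀ := 1 - q * (i / N) with hX₀
  have h2N : 0 < 2 / N := by positivity
  have hX1p : 0 < X₁ := h2N.trans_le hX1
  have hX0p : 0 < X₀ := h2N.trans_le hX0
  have hdiff : X₀ - X₁ = q / N := by
    rw [hX₀, hX₁]
    push_cast
    ring
  have hh : x (i + 1) - x i = σ * ε * Real.log (X₀ / X₁) := by
    rw [hxi, hxi1, Real.log_div hX0p.ne' hX1p.ne']
    ring
  have hσε : 0 < σ * ε := by positivity
  have hlog : Real.log (X₀ / X₁) ≤ 2 / N / X₁ := by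
    refine (Real.log_le_sub_one_of_pos (by positivity)).trans ?_
    have h1 : X₀ / X₁ - 1 = (X₀ - X₁) / X₁ := by field_simp
    rw [h1, hdiff]
    gcongr
  have hexp : Real.exp (x (i + 1) / (σ * ε)) = 1 / X₁ := by
    have h1 : x (i + 1) / (σ * ε) = -Real.log X₁ := by
      rw [hxi1]
      field_simp
    rw [h1, Real.exp_neg, Real.exp_log hX1p, one_div]
  rw [hexp, hh]
  refine ⟨?_, ?_, fun hin => ?_⟩
  · have : 2 / N / X₁ ≤ 1 := (div_le_one hX1p).2 hX1
    exact mul_le_of_le_one_right hσε.le (hlog.trans this)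
  · have h1 : σ * ε * Real.log (X₀ / X₁) / ε = σ * Real.log (X₀ / X₁) := by field_simp
    rw [h1]
    refine (mul_le_mul_of_nonneg_left hlog hσ.le).trans (le_of_eq ?_)
    field_simp
  · have h1 : 1 - X₁ / X₀ ≤ Real.log (X₀ / X₁) := by
      have := Real.one_sub_inv_le_log_of_pos (show 0 < X₀ / X₁ by positivity)
      rwa [inv_div] at this
    have h2 : 1 - X₁ / X₀ = q / N / X₀ := by
      rw [← hdiff]
      field_simp
    have h3 : X₀ ≤ 5 / N := by
      have e1 : X₁ ≤ 3 / N := by rw [hX₁, hin]; exact hqn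
      have e2 : q / N ≤ 2 / N := by gcongr
      have e3 : 5 / N = 3 / N + 2 / N := by ring
      linarith
    have h4 : 1 / 5 ≤ q / N / X₀ := by
      rw [le_div_iff₀ hX0p]
      have e1 : 1 / N ≤ q / N := by gcongr
      have e2 : 1 / 5 * (5 / N) = 1 / N := by ring
      linarith
    have h5 : 1 / 5 ≤ Real.log (X₀ / X₁) := by linarith
    have h6 := mul_le_mul_of_nonneg_left h5 hσε.le
    linarith

/-- The left side equals `X^σ` for the last argument `X ≤ min(1, 3/N)` of the logarithm, and `σ ≥
k`. -/
lemma IsBakhvalovMesh.exp_le (hx : IsBakhvalovMesh σ ε H n x) (hε : 0 < ε) {k : ℕ}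
    (hk : (k : ℝ) ≤ σ) : Real.exp (-(x n / ε)) ≤ (3 / (2 * (n + 1) : ℕ)) ^ k := by
  obtain ⟨q, hq1, hq2, hqn, hxq⟩ := hx.graded
  have hN : (0 : ℝ) < ((2 * (n + 1) : ℕ) : ℝ) := by positivity
  have hX := two_div_le_grading (n := n) hq2 (i := n) le_rfl
  set X := 1 - q * ((n : ℝ) / (2 * (n + 1) : ℕ)) with hXdef
  have hXp : 0 < X := lt_of_lt_of_le (by positivity) hX
  have hX1 : X ≤ 1 := by
    have : 0 ≤ q * ((n : ℝ) / (2 * (n + 1) : ℕ)) := by positivity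
    linarith
  have h1 : -(x n / ε) = σ * Real.log X := by
    rw [hxq n le_rfl, ← hXdef]
    field_simp
  have h2 : σ * Real.log X ≤ k * Real.log X :=
    mul_le_mul_of_nonpos_right hk (Real.log_nonpos hXp.le hX1)
  calc Real.exp (-(x n / ε)) ≤ Real.exp (k * Real.log X) := Real.exp_le_exp.2 (h1 ▸ h2)
    _ = X ^ k := by rw [Real.exp_nat_mul, Real.exp_log hXp]
    _ ≤ _ := pow_le_pow_left₀ hXp.le hqn k

lemma layerWeight_anti {β τ s t : ℝ} (hβ : 0 ≤ β) (hε : 0 < ε) (hst : s ≤ t) :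
    layerWeight β ε τ t ≤ layerWeight β ε τ s := by
  unfold layerWeight
  gcongr

/-- Beyond the graded part the layer is small. -/
lemma IsBakhvalovMesh.layerWeight_le_of_le (hx : IsBakhvalovMesh σ ε H n x) (hε : 0 < ε)
    (hεN : ε ≤ 1 / (2 * (n + 1) : ℕ)) {k : ℕ} (hk : (k : ℝ) ≤ σ) {δ t : ℝ} (ht : x n ≤ t) :
    layerWeight (1 + δ) ε (ε ^ (k + 1)) t ≤
      3 ^ k / ((2 * (n + 1) : ℕ) : ℝ) ^ k * layerWeight δ ε ε t := by
  have hN : (0 : ℝ) < ((2 * (n + 1) : ℕ) : ℝ) := by positivity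
  have h1 := hx.exp_le hε hk
  rw [div_pow] at h1
  unfold layerWeight
  rw [mul_add]
  refine add_le_add ?_ ?_
  · have h2 : Real.exp (-((1 + δ) * t / ε)) = Real.exp (-(t / ε)) * Real.exp (-(δ * t / ε)) := by
      rw [← Real.exp_add]
      congr 1
      ring
    rw [h2]
    refine mul_le_mul_of_nonneg_right (le_trans (Real.exp_le_exp.2 ?_) h1) (Real.exp_pos _).le
    have := div_le_div_of_nonneg_right ht hε.le
    linarith
  · rw [pow_succ]
    refine mul_le_mul_of_nonneg_right ?_ hε.le
    refine (pow_le_pow_left₀ hε.le hεN k).trans ?_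
    rw [one_div, inv_pow, ← one_div]
    gcongr
    exact one_le_pow₀ (by norm_num)

/-- In the graded part the local mesh width compensates the layer. -/
lemma IsBakhvalovMesh.width_pow_mul_layerWeight_le (hx : IsBakhvalovMesh σ ε H n x) (hσ : 0 < σ)
    (hε : 0 < ε) (hεN : ε ≤ 1 / (2 * (n + 1) : ℕ)) {k : ℕ} (hk : (k : ℝ) ≤ σ) {δ : ℝ}
    (hδ : 0 ≤ δ) {i : ℕ} (hi : i < n) :
    ((x (i + 1) - x i) / ε) ^ k * layerWeight (1 + δ) ε (ε ^ (k + 1)) (x i) ≤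
      (2 * σ) ^ k * Real.exp ((1 + δ) * σ) / ((2 * (n + 1) : ℕ) : ℝ) ^ k *
        layerWeight δ ε ε (x (i + 1)) := by
  obtain ⟨h1, h2, -⟩ := hx.graded_width hσ hε hi
  have hpos : 0 < x (i + 1) - x i := sub_pos.2 (hx.lt i (by omega))
  have hx1 : 0 ≤ x (i + 1) := by
    rw [← hx.zero]
    exact hx.toIsMesh.le (by omega) (by omega)
  set N : ℝ := ((2 * (n + 1) : ℕ) : ℝ) with hNdef
  have hN : 0 < N := by rw [hNdef]; positivity
  set h := x (i + 1) - x i with hh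
  -- The `k`-th power of `e^{x/(σε)}` is at most `e^{x/ε}`, since `k ≤ σ`.
  have hp1 : (h / ε) ^ k ≤ (2 * σ) ^ k / N ^ k * Real.exp (x (i + 1) / ε) := by
    refine (pow_le_pow_left₀ (by positivity) h2 k).trans ?_
    rw [mul_pow, div_pow, ← Real.exp_nat_mul]
    refine mul_le_mul_of_nonneg_left (Real.exp_le_exp.2 ?_) (by positivity)
    have : k * (x (i + 1) / (σ * ε)) = (k / σ) * (x (i + 1) / ε) := by field_simp
    rw [this]
    exact mul_le_of_le_one_left (by positivity) ((div_le_one hσ).2 hk)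
  -- This cruder bound serves the summand `ε^(k+1)` of the weight, where `ε^k ≤ N^{-k}` supplies the
  -- rate.
  have hp2 : (h / ε) ^ k ≤ σ ^ k := by
    refine pow_le_pow_left₀ (by positivity) ?_ k
    rwa [div_le_iff₀ hε]
  have hexp : 1 ≤ Real.exp ((1 + δ) * σ) := Real.one_le_exp (by positivity)
  unfold layerWeight
  rw [mul_add, mul_add]
  refine add_le_add ?_ ?_
  · refine (mul_le_mul_of_nonneg_right hp1 (Real.exp_pos _).le).trans ?_
    have e1 : Real.exp (x (i + 1) / ε) * Real.exp (-((1 + δ) * x i / ε)) ≤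
        Real.exp ((1 + δ) * σ) * Real.exp (-(δ * x (i + 1) / ε)) := by
      rw [← Real.exp_add, ← Real.exp_add]
      refine Real.exp_le_exp.2 ?_
      -- Passing from `x i` to `x (i+1)` in the weight costs only `e^{(1+δ)σ}`, because `h ≤ σ ε`.
      have e2 : (1 + δ) * (h / ε) ≤ (1 + δ) * σ :=
        mul_le_mul_of_nonneg_left ((div_le_iff₀ hε).2 h1) (by positivity)
      have e3 : (1 + δ) * (h / ε) = x (i + 1) / ε + -((1 + δ) * x i / ε) + δ * x (i + 1) / ε := by
        rw [hh]
        ring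
      linarith
    have e4 := mul_le_mul_of_nonneg_left e1 (show 0 ≤ (2 * σ) ^ k / N ^ k by positivity)
    calc _ = (2 * σ) ^ k / N ^ k * (Real.exp (x (i + 1) / ε) * Real.exp (-((1 + δ) * x i / ε))) := by
          ring
      _ ≤ _ := e4
      _ = _ := by ring
  · have e1 : ε ^ k ≤ 1 / N ^ k := by
      have := pow_le_pow_left₀ hε.le hεN k
      rwa [one_div, inv_pow, ← one_div] at this
    have e2 : σ ^ k ≤ (2 * σ) ^ k * Real.exp ((1 + δ) * σ) :=
      (pow_le_pow_left₀ hσ.le (by linarith) k).trans (le_mul_of_one_le_right (by positivity) hexp)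
    rw [pow_succ, ← mul_assoc]
    refine mul_le_mul_of_nonneg_right ?_ hε.le
    calc (h / ε) ^ k * ε ^ k ≤ (2 * σ) ^ k * Real.exp ((1 + δ) * σ) * (1 / N ^ k) :=
          mul_le_mul (hp2.trans e2) e1 (by positivity) (by positivity)
      _ = _ := by ring

lemma IsBakhvalovMesh.exists_smooth_approximation (hx : IsBakhvalovMesh σ ε H n x) {k : ℕ}
    (hk : 1 ≤ k) {S : ℝ → ℝ} {C : ℝ} (hH : 0 ≤ H) (hS : ContDiff ℝ (k + 1 : ℕ) S)
    (hC : ∀ t ∈ Icc (0 : ℝ) 1, |iteratedDeriv (k + 1) S t| ≤ C) :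
    ∃ W : ℝ → ℝ, Continuous W ∧ W 0 = S 0 ∧ W 1 = S 1 ∧
      (∀ i < 2 * (n + 1), ∃ p : Polynomial ℝ, p.natDegree ≤ k ∧
        ∀ t ∈ Icc (x i) (x (i + 1)), W t = p.eval t) ∧
      ∀ t ∈ Ioo (0 : ℝ) 1 \ meshSet (2 * (n + 1)) x,
        |S t - W t| ≤ 3 * C * (H ^ (k + 1) + H ^ k) / ((2 * (n + 1) : ℕ) : ℝ) ^ k ∧
        |deriv (fun t => S t - W t) t| ≤
          3 * C * (H ^ (k + 1) + H ^ k) / ((2 * (n + 1) : ℕ) : ℝ) ^ k := by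
  have hC0 : 0 ≤ C := (abs_nonneg _).trans (hC 0 (by simp))
  have key := hx.toIsMesh.exists_approximation (k := k) (w := S) (y := fun i => S (x i))
    (F := fun _ => 3 * C * (H ^ (k + 1) + H ^ k) / ((2 * (n + 1) : ℕ) : ℝ) ^ k)
    (G := fun _ => 3 * C * (H ^ (k + 1) + H ^ k) / ((2 * (n + 1) : ℕ) : ℝ) ^ k) (fun i hi => ?_)
    (contDiff_of_le (n := 1) hS (by omega)) (by omega)
  · simp only [hx.zero, hx.last] at key
    exact key
  have hlt := hx.lt i hi
  have hsub : Icc (x i) (x (i + 1)) ⊆ Icc 0 1 := by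
    refine Icc_subset_Icc ?_ ?_
    · rw [← hx.zero]
      exact hx.toIsMesh.le (by omega) (by omega)
    · rw [← hx.last]
      exact hx.toIsMesh.le (by omega) le_rfl
  obtain ⟨p, hp, hpl, hpr, hpb⟩ := exists_polynomial_with_endpoints (M := 0) hk hS hlt
    (fun t ht => hC t (hsub ht)) (y := S (x i)) (z := S (x (i + 1))) (by simp) (by simp)
  have hw := hx.width i hi
  set h := x (i + 1) - x i with hh
  have hh0 : 0 < h := sub_pos.2 hlt
  set N : ℝ := ((2 * (n + 1) : ℕ) : ℝ) with hNdef
  have hN : 1 ≤ N := by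
    rw [hNdef]
    exact_mod_cast (by omega)
  have hk1 : h ^ k ≤ H ^ k / N ^ k := by
    rw [← div_pow]
    exact pow_le_pow_left₀ hh0.le hw k
  have hhH : h ≤ H := hw.trans (div_le_self hH hN)
  have hk2 : h ^ (k + 1) ≤ H ^ (k + 1) / N ^ k := by
    rw [pow_succ, pow_succ, mul_div_right_comm]
    exact mul_le_mul hk1 hhH hh0.le (by positivity)
  have hsum : 3 * C * (H ^ (k + 1) + H ^ k) / N ^ k
      = 3 * C * (H ^ (k + 1) / N ^ k) + 3 * C * (H ^ k / N ^ k) := by ring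
  have hn1 : 0 ≤ 3 * C * (H ^ (k + 1) / N ^ k) := by positivity
  have hn2 : 0 ≤ 3 * C * (H ^ k / N ^ k) := by positivity
  refine ⟨p, hp, hpl, hpr, fun t ht => ⟨?_, ?_⟩⟩
  · have h1 := (hpb t ht).1
    have h2 := mul_le_mul_of_nonneg_left hk2 (show 0 ≤ 3 * C by positivity)
    simp only [hsum]
    linarith
  · have h1 := (hpb t ht).2
    have h3 : |deriv S t - p.derivative.eval t| ≤ 3 * C * h ^ k := by
      refine le_of_mul_le_mul_left ?_ hh0
      refine h1.trans (le_of_eq ?_)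
      ring
    have h2 := mul_le_mul_of_nonneg_left hk1 (show 0 ≤ 3 * C by positivity)
    simp only [hsum]
    linarith

lemma IsBakhvalovMesh.exists_layer_approximation (hx : IsBakhvalovMesh σ ε H n x) {k : ℕ}
    (hk : 1 ≤ k) (hn : 1 ≤ n) (hε : 0 < ε) (hεN : ε ≤ 1 / (2 * (n + 1) : ℕ)) (hσ : (k : ℝ) ≤ σ)
    {r : ℝ → ℝ} {C δ : ℝ} (hC0 : 0 ≤ C) (hδ : 0 ≤ δ) (hr : ContDiff ℝ (k + 1 : ℕ) r)
    (hC : ∀ i ≤ k + 1, ∀ t ∈ Icc (0 : ℝ) 1,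
      ε ^ i * |iteratedDeriv i r t| ≤ C * layerWeight (1 + δ) ε (ε ^ (k + 1)) t) :
    ∃ W : ℝ → ℝ, Continuous W ∧ W 0 = r 0 ∧ W 1 = 0 ∧
      (∀ i < 2 * (n + 1), ∃ p : Polynomial ℝ, p.natDegree ≤ k ∧
        ∀ t ∈ Icc (x i) (x (i + 1)), W t = p.eval t) ∧
      ∀ t ∈ Ioo (0 : ℝ) 1 \ meshSet (2 * (n + 1)) x,
        |r t - W t| ≤ C * (3 * ((2 * σ) ^ k * Real.exp ((1 + δ) * σ)) * (1 + σ)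
            + 2 * 3 ^ k * (1 + 5 / σ)) / ((2 * (n + 1) : ℕ) : ℝ) ^ k * layerWeight δ ε ε t ∧
        ε * |deriv (fun t => r t - W t) t| ≤
          C * (3 * ((2 * σ) ^ k * Real.exp ((1 + δ) * σ)) * (1 + σ)
            + 2 * 3 ^ k * (1 + 5 / σ)) / ((2 * (n + 1) : ℕ) : ℝ) ^ k * layerWeight δ ε ε t := by
  have hσ0 : 0 < σ := lt_of_lt_of_le (by exact_mod_cast hk) hσ
  set N : ℝ := ((2 * (n + 1) : ℕ) : ℝ) with hNdef
  have hN : 0 < N := by rw [hNdef]; positivity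
  set c₁ := (2 * σ) ^ k * Real.exp ((1 + δ) * σ) with hc₁
  have hc₁0 : 0 < c₁ := by positivity
  set Q := C * (3 * c₁ * (1 + σ) + 2 * 3 ^ k * (1 + 5 / σ)) / N ^ k with hQ
  have hQs : Q = 3 * (C * (c₁ / N ^ k)) + 3 * (σ * (C * (c₁ / N ^ k))) + 2 * (C * (3 ^ k / N ^ k))
      + 2 * (5 / σ * (C * (3 ^ k / N ^ k))) := by
    rw [hQ]
    ring
  have hW0 : ∀ t, 0 < layerWeight δ ε ε t := fun t => layerWeight_pos hε.le
  have q1 : 0 ≤ C * (c₁ / N ^ k) := by positivity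
  have q2 : 0 ≤ σ * (C * (c₁ / N ^ k)) := by positivity
  have q3 : 0 ≤ C * (3 ^ k / N ^ k) := by positivity
  have q4 : 0 ≤ 5 / σ * (C * (3 ^ k / N ^ k)) := by positivity
  have hτ : 0 ≤ ε ^ (k + 1) := by positivity
  have key := hx.toIsMesh.exists_approximation (k := k) (w := r)
    -- Nodal values of the layer approximant: those of `r` before `x n`, zero from `x n` on. On the
    -- interval ending at `x n` it descends to zero. The condition `1 ≤ n` keeps the value at `0`
    -- equal to `r 0`.
    (y := fun i => if i < n then r (x i) else 0)
    (F := fun t => Q * layerWeight δ ε ε t) (G := fun t => Q * layerWeight δ ε ε t / ε)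
    (fun i hi => ?_) (contDiff_of_le (n := 1) hr (by omega)) (by omega)
  · obtain ⟨W, h1, h2, h3, h4, h5⟩ := key
    rw [if_pos (by omega), hx.zero] at h2
    rw [if_neg (by omega)] at h3
    refine ⟨W, h1, h2, h3, h4, fun t ht => ⟨(h5 t ht).1, ?_⟩⟩
    have := (h5 t ht).2
    rw [le_div_iff₀ hε] at this
    linarith
  have hlt := hx.lt i hi
  have hsub : Icc (x i) (x (i + 1)) ⊆ Icc 0 1 := by
    refine Icc_subset_Icc ?_ ?_
    · rw [← hx.zero]
      exact hx.toIsMesh.le (by omega) (by omega)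
    · rw [← hx.last]
      exact hx.toIsMesh.le (by omega) le_rfl
  rcases Nat.lt_or_ge i n with hin | hin
  · -- graded part
    obtain ⟨hw1, -, hw3⟩ := hx.graded_width hσ0 hε hin
    have hpw := hx.width_pow_mul_layerWeight_le hσ0 hε hεN hσ hδ hin
    have htail := hx.layerWeight_le_of_le hε hεN hσ (δ := δ) (t := x n) le_rfl
    set h := x (i + 1) - x i with hh
    have hh0 : 0 < h := sub_pos.2 hlt
    set w₀ := layerWeight (1 + δ) ε (ε ^ (k + 1)) (x i) with hw₀
    -- End point mismatch, present only on the interval ending at `x n`, where `|r (x n)|` is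
    -- already of order `N^{-k}`.
    set M : ℝ := if i + 1 < n then 0 else C * (3 ^ k / N ^ k * layerWeight δ ε ε (x (i + 1))) with hM
    have hM0 : 0 ≤ M := by
      rw [hM]
      split_ifs
      · exact le_rfl
      · have := (hW0 (x (i + 1))).le
        positivity
    have hMle : M ≤ C * (3 ^ k / N ^ k) * layerWeight δ ε ε (x (i + 1)) := by
      rw [hM]
      split_ifs
      · have := (hW0 (x (i + 1))).le
        positivity
      · exact le_of_eq (by ring)
    have hMh : ε / h * M ≤ 5 / σ * (C * (3 ^ k / N ^ k)) * layerWeight δ ε ε (x (i + 1)) := by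
      by_cases hi1 : i + 1 < n
      · have : M = 0 := if_pos hi1
        rw [this, mul_zero]
        have := (hW0 (x (i + 1))).le
        positivity
      · have h1 := hw3 (by omega)
        have h2 : ε / h ≤ 5 / σ := by
          rw [div_le_div_iff₀ hh0 hσ0]
          linarith
        have := mul_le_mul h2 hMle hM0 (by positivity)
        linarith
    have hK : ∀ t ∈ Icc (x i) (x (i + 1)), |iteratedDeriv (k + 1) r t| ≤
        C * w₀ / ε ^ (k + 1) := by
      intro t ht
      rw [le_div_iff₀ (by positivity), mul_comm]
      refine (hC (k + 1) le_rfl t (hsub ht)).trans (mul_le_mul_of_nonneg_left ?_ hC0)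
      exact layerWeight_anti (by linarith) hε ht.1
    have hend : |r (x (i + 1)) - (if i + 1 < n then r (x (i + 1)) else 0)| ≤ M := by
      by_cases hi1 : i + 1 < n
      · rw [if_pos hi1, sub_self, abs_zero]
        exact hM0
      · have hi2 : i + 1 = n := by omega
        have e1 : M = C * (3 ^ k / N ^ k * layerWeight δ ε ε (x (i + 1))) := if_neg hi1
        rw [if_neg hi1, sub_zero, e1, hi2]
        have := hC 0 (by omega) (x n) (hi2 ▸ hsub (right_mem_Icc.2 hlt.le))
        rw [pow_zero, one_mul, iteratedDeriv_zero] at this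
        exact this.trans (mul_le_mul_of_nonneg_left htail hC0)
    obtain ⟨p, hp, hpl, hpr, hpb⟩ := exists_polynomial_with_endpoints (M := M) hk hr hlt hK
      (y := r (x i)) (z := if i + 1 < n then r (x (i + 1)) else 0) (by simpa using hM0) hend
    -- Only `k` of the `k+1` factors `h/ε` are used against the layer. The remaining one is bounded
    -- by `σ` for values and cancels for the derivative.
    have hEh : C * w₀ / ε ^ (k + 1) * h ^ (k + 1) = h / ε * (C * ((h / ε) ^ k * w₀)) := by
      rw [div_pow, pow_succ, pow_succ]
      field_simp
    have hCp := mul_le_mul_of_nonneg_left hpw hC0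
    have hCw : C * ((h / ε) ^ k * w₀) ≤ C * (c₁ / N ^ k) * layerWeight δ ε ε (x (i + 1)) := by
      linarith
    have hhε : h / ε ≤ σ := (div_le_iff₀ hε).2 hw1
    have hw₀0 : 0 < w₀ := layerWeight_pos hτ
    have hE : h / ε * (C * ((h / ε) ^ k * w₀)) ≤
        σ * (C * (c₁ / N ^ k)) * layerWeight δ ε ε (x (i + 1)) := by
      have := mul_le_mul hhε hCw (by positivity) hσ0.le
      linarith
    refine ⟨p, hp, by rw [if_pos hin]; exact hpl, hpr, fun t ht => ?_⟩
    have hanti := layerWeight_anti (β := δ) (τ := ε) hδ hε ht.2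
    have hQt : ∀ a, 0 ≤ a → a * layerWeight δ ε ε (x (i + 1)) ≤ a * layerWeight δ ε ε t :=
      fun a ha => mul_le_mul_of_nonneg_left hanti ha
    have w1 := mul_nonneg q1 (hW0 t).le
    have w2 := mul_nonneg q2 (hW0 t).le
    have w3 := mul_nonneg q3 (hW0 t).le
    have w4 := mul_nonneg q4 (hW0 t).le
    have g1 := hQt _ q1
    have g2 := hQt _ q2
    have g3 := hQt _ q3
    have g4 := hQt _ q4
    obtain ⟨b1, b2⟩ := hpb t ht
    rw [hEh] at b1 b2
    rw [hQs]
    refine ⟨by linarith, ?_⟩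
    rw [le_div_iff₀ hε]
    have b3 : |deriv r t - p.derivative.eval t| * ε ≤
        3 * (C * ((h / ε) ^ k * w₀)) + 2 * (ε / h * M) := by
      have := mul_le_mul_of_nonneg_left b2 (show 0 ≤ ε / h by positivity)
      have e1 : ε / h * (h * |deriv r t - p.derivative.eval t|)
          = |deriv r t - p.derivative.eval t| * ε := by field_simp
      have e2 : ε / h * (3 * (h / ε * (C * ((h / ε) ^ k * w₀))) + 2 * M)
          = 3 * (C * ((h / ε) ^ k * w₀)) + 2 * (ε / h * M) := by
        have : ε / h * (h / ε) = 1 := by field_simp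
        linear_combination (3 * (C * ((h / ε) ^ k * w₀))) * this
      linarith
    linarith
  · -- coarse part
    -- The approximant is zero here, so the errors are `r` and `r'` themselves. They are small
    -- beyond `x n`, and the interval width plays no role.
    refine ⟨0, by simp, by simp [not_lt.2 hin], by simp [show ¬ i + 1 < n by omega], fun t ht => ?_⟩
    have hxt : x n ≤ t := (hx.toIsMesh.le hin (by omega)).trans ht.1
    have htail := mul_le_mul_of_nonneg_left
      (hx.layerWeight_le_of_le hε hεN hσ (δ := δ) hxt) hC0
    have h0 := hC 0 (by omega) t (hsub ht)
    have h1 := hC 1 (by omega) t (hsub ht)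
    rw [pow_zero, one_mul, iteratedDeriv_zero] at h0
    rw [pow_one, iteratedDeriv_one] at h1
    have w1 := mul_nonneg q1 (hW0 t).le
    have w2 := mul_nonneg q2 (hW0 t).le
    have w3 := mul_nonneg q3 (hW0 t).le
    have w4 := mul_nonneg q4 (hW0 t).le
    rw [le_div_iff₀ hε, hQs]
    simp only [Polynomial.eval_zero, Polynomial.derivative_zero, sub_zero]
    constructor <;> linarith

end BakhvalovFEM

namespace BakhvalovFEM

/-! ### The error estimate on Bakhvalov-type meshes -/

lemma bilin_sub_left {s : Set ℝ} {ε : ℝ} {b c v v' w : ℝ → ℝ} (hs : s.Countable) (hb : Continuous b)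
    (hc : Continuous c) (hv : PiecewiseDiff s v) (hv' : PiecewiseDiff s v')
    (hw : PiecewiseDiff s w) :
    bilin ε b c (fun x => v x - v' x) w = bilin ε b c v w - bilin ε b c v' w := by
  rw [bilin_eq hs hb hc (hv.sub hv') hw, bilin_eq hs hb hc hv hw, bilin_eq hs hb hc hv' hw,
    ← integral_sub (essBdd_bilin hs hb hc hv hw).integrable'
      (essBdd_bilin hs hb hc hv' hw).integrable']
  refine integral_congr_ae (ae_unitMeasure hs fun x hx => ?_)
  beta_reduce
  rw [deriv_fun_sub (hv.differentiableAt x hx) (hv'.differentiableAt x hx)]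
  ring

lemma bilin_congr {ε : ℝ} {b b' c c' v w : ℝ → ℝ} (hb : EqOn b b' (Icc 0 1))
    (hc : EqOn c c' (Icc 0 1)) : bilin ε b c v w = bilin ε b' c' v w := by
  unfold bilin
  congr 1
  · congr 1
    refine intervalIntegral.integral_congr fun x hx => ?_
    rw [uIcc_of_le zero_le_one] at hx
    rw [hb hx]
  · refine intervalIntegral.integral_congr fun x hx => ?_
    rw [uIcc_of_le zero_le_one] at hx
    rw [hc hx]

lemma deriv_eq_of_eqOn {v w : ℝ → ℝ} (h : EqOn v w (Icc 0 1)) {x : ℝ} (hx : x ∈ Ioo (0 : ℝ) 1) :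
    deriv v x = deriv w x := by
  refine Filter.EventuallyEq.deriv_eq ?_
  filter_upwards [Ioo_mem_nhds hx.1 hx.2] with y hy using h (Ioo_subset_Icc_self hy)

lemma energyNorm_congr {ε : ℝ} {v w : ℝ → ℝ} (h : EqOn v w (Icc 0 1)) :
    energyNorm ε v = energyNorm ε w := by
  have h1 : ∫ x, deriv v x ^ 2 ∂unitMeasure = ∫ x, deriv w x ^ 2 ∂unitMeasure :=
    integral_congr_ae (ae_unitMeasure countable_empty fun x hx => by
      beta_reduce
      rw [deriv_eq_of_eqOn h hx.1])
  have h2 : ∫ x, v x ^ 2 ∂unitMeasure = ∫ x, w x ^ 2 ∂unitMeasure :=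
    integral_congr_ae (ae_unitMeasure countable_empty fun x hx => by
      beta_reduce
      rw [h (Ioo_subset_Icc_self hx.1)])
  simp only [energyNorm, integral_unit, h1, h2]

lemma FiniteEnergy.congr {v w : ℝ → ℝ} (hv : FiniteEnergy v) (h : EqOn v w (Icc 0 1)) :
    FiniteEnergy w :=
  ⟨hv.1.ae_eq (ae_unitMeasure countable_empty fun _ hx => h (Ioo_subset_Icc_self hx.1)),
    hv.2.ae_eq (ae_unitMeasure countable_empty fun _ hx => deriv_eq_of_eqOn h hx.1)⟩

lemma equation_of_eqOn {ε : ℝ} {b c f u U : ℝ → ℝ} (hu : IsSolution ε b c f u) (hb : Continuous b)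
    (hc : Continuous c) (hf : Continuous f) (hU : ContDiff ℝ 2 U) (hUu : EqOn U u (Icc 0 1)) :
    ∀ x ∈ Icc (0 : ℝ) 1, -ε * deriv (deriv U) x - b x * deriv U x + c x * U x = f x := by
  have h1 : EqOn (fun x => -ε * deriv (deriv U) x - b x * deriv U x + c x * U x) f (Ioo 0 1) := by
    intro x hx
    have e1 : deriv U =ᶠ[nhds x] deriv u := by
      filter_upwards [Ioo_mem_nhds hx.1 hx.2] with y hy using deriv_eq_of_eqOn hUu hy
    beta_reduce
    rw [e1.deriv_eq, e1.eq_of_nhds, hUu (Ioo_subset_Icc_self hx)]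
    exact hu.equation x hx
  have h2 : Continuous fun x => -ε * deriv (deriv U) x - b x * deriv U x + c x * U x := by
    have hU' := contDiff_deriv (n := 1) hU
    have := (contDiff_deriv (n := 0) hU').continuous
    have := hU'.continuous
    have := hU.continuous
    fun_prop
  have h3 := h1.closure h2 hf
  rwa [closure_Ioo zero_ne_one] at h3

/-- The error estimate for data that are smooth on the whole line. -/
theorem exists_error_bound_of_contDiff {k : ℕ} (hk : 1 ≤ k) {b c f p : ℝ → ℝ} {β γ σ H : ℝ}
    (hb : ContDiff ℝ (2 * k + 3 : ℕ) b) (hc : ContDiff ℝ (2 * k + 3 : ℕ) c)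
    (hf : ContDiff ℝ (2 * k + 3 : ℕ) f) (hp : ContDiff ℝ (2 * k + 3 : ℕ) p)
    (hbp : ∀ x ∈ Icc (0 : ℝ) 1, b x * p x = 1) (hβ : 1 < β) (hbβ : ∀ x ∈ Icc (0 : ℝ) 1, β ≤ b x)
    (hγ : 0 < γ) (hcb : ∀ x ∈ Icc (0 : ℝ) 1, γ ≤ c x + 1 / 2 * deriv b x)
    (hσ : (k : ℝ) ≤ σ) (hH : 0 ≤ H) :
    ∃ C : ℝ, 0 < C ∧ ∀ (ε : ℝ) (n : ℕ) (x : ℕ → ℝ), 0 < ε → ε ≤ 1 / (2 * (n + 1) : ℕ) →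
      IsBakhvalovMesh σ ε H n x → ∀ U uN : ℝ → ℝ, ContDiff ℝ (k + 3 : ℕ) U →
      (∀ x ∈ Icc (0 : ℝ) 1, -ε * deriv (deriv U) x - b x * deriv U x + c x * U x = f x) →
      U 0 = 0 → U 1 = 0 → IsGalerkinSolution ε b c f k (2 * (n + 1)) x uN →
      FiniteEnergy (fun x => U x - uN x) ∧
      energyNorm ε (fun x => U x - uN x) ≤ C / ((2 * (n + 1) : ℕ) : ℝ) ^ k := by
  have hσ0 : 0 < σ := lt_of_lt_of_le (by exact_mod_cast hk) hσ
  have hb1 : ContDiff ℝ 1 b := contDiff_of_le (n := 1) hb (by omega)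
  -- Expansion up to `ε^k` with `k+1` controlled derivatives. This consumes `2k+2` derivatives of
  -- `c`, `1/b` and `f`.
  obtain ⟨S, g, D, hg, hD, hS, hS1, hSD, hSe⟩ := exists_smooth_part (n := k + 1) hbp k
    (contDiff_of_le hc (by omega)) (contDiff_of_le hp (by omega)) f (contDiff_of_le hf (by omega))
  -- The layer rate is `1 + δ`, halfway between `1` and `β`: strictly below `β` for the barrier,
  -- strictly above `1` to leave `e^{-δx/ε}`.
  set δ := (β - 1) / 2 with hδ
  have hδ0 : 0 < δ := half_pos (sub_pos.2 hβ)
  obtain ⟨ε₀, L, hε₀, hL, hlayer⟩ := exists_layer_derivative_bound (n := k + 1) (β' := 1 + δ)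
    (R := D) (by omega) (contDiff_of_le hb (by omega)) (contDiff_of_le hc (by omega)) hg
    (by positivity) (by linarith) hbβ hD
  obtain ⟨K₁, hK₁, henergy⟩ := exists_energyNorm_le hb1 hc.continuous hγ hδ0 hcb
  obtain ⟨K₂, hK₂, hstab⟩ := exists_energyNorm_sub_le hb1 hc.continuous hf.continuous hγ hcb
  set Q₁ := 3 * D * (H ^ (k + 1) + H ^ k) with hQ₁
  set Q₂ := L * (3 * ((2 * σ) ^ k * Real.exp ((1 + δ) * σ)) * (1 + σ)
            + 2 * 3 ^ k * (1 + 5 / σ)) with hQ₂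
  have hQ₁0 : 0 ≤ Q₁ := by positivity
  have hQ₂0 : 0 ≤ Q₂ := by positivity
  refine ⟨K₁ * (Q₁ + Q₂) + K₂ * (4 + 1 / ε₀) ^ k + 1, by positivity, ?_⟩
  intro ε n x hε hεN hx U uN hU hUe hU0 hU1 hG
  set N : ℝ := ((2 * (n + 1) : ℕ) : ℝ) with hNdef
  have hN : 1 ≤ N := by
    rw [hNdef]
    exact_mod_cast (by omega)
  have hN0 : 0 < N := by linarith
  have hε1 : ε ≤ 1 := hεN.trans ((div_le_one hN0).2 hN)
  have hs := countable_meshSet (2 * (n + 1)) x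
  have hU2 : ContDiff ℝ 2 U := contDiff_of_le (n := 2) hU (by omega)
  have hUp : PiecewiseDiff (meshSet (2 * (n + 1)) x) U := .of_contDiff _ (hU2.of_le (by norm_num))
  have huNp := hx.toIsMesh.piecewiseDiff_of_mem_femSpace hG.1
  have hep := hUp.sub huNp
  refine ⟨hep.finiteEnergy hs, ?_⟩
  have hP : 0 ≤ K₂ * (4 + 1 / ε₀) ^ k := by positivity
  by_cases hcase : 1 ≤ n ∧ ε ≤ ε₀
  · obtain ⟨hn, hεε₀⟩ := hcase
    have hSε := hS ε
    have hS2 : ContDiff ℝ 2 (S ε) := contDiff_of_le (n := 2) hSε (by omega)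
    have hεI : ε ∈ Icc (0 : ℝ) 1 := ⟨hε.le, hε1⟩
    set r : ℝ → ℝ := fun x => U x - S ε x with hr
    have hrc : ContDiff ℝ (k + 3 : ℕ) r := hU.sub hSε
    have hre : ∀ x ∈ Icc (0 : ℝ) 1,
        -ε * deriv (deriv r) x - b x * deriv r x + c x * r x = ε ^ (k + 1) * g x := by
      intro y hy
      have e1 : deriv r = fun y => deriv U y - deriv (S ε) y := funext fun y =>
        deriv_fun_sub (hU2.differentiable (by simp) y) (hS2.differentiable (by simp) y)
      have e2 : deriv (fun y => deriv U y - deriv (S ε) y) y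
          = deriv (deriv U) y - deriv (deriv (S ε)) y :=
        deriv_fun_sub ((contDiff_deriv (n := 1) hU2).differentiable (by simp) y)
          ((contDiff_deriv (n := 1) hS2).differentiable (by simp) y)
      rw [e1, e2]
      have h1 := hUe y hy
      have h2 := hSe ε y hy
      simp only [hr]
      linear_combination h1 - h2
    have hr0 : |r 0| ≤ D := by
      have := hSD ε hεI 0 (by simp) 0 (by omega)
      rw [iteratedDeriv_zero] at this
      simpa [hr, hU0] using this
    have hr1 : r 1 = 0 := by simp [hr, hU1, hS1]
    have hrb := hlayer ε (ε ^ (k + 1)) hε hεε₀ (by positivity) r hrc hre hr0 hr1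
    obtain ⟨WS, hWSc, hWS0, hWS1, hWSp, hWSb⟩ := hx.exists_smooth_approximation hk hH
      (contDiff_of_le hSε (by omega)) (fun t ht => hSD ε hεI t ht (k + 1) le_rfl)
    obtain ⟨WR, hWRc, hWR0, hWR1, hWRp, hWRb⟩ := hx.exists_layer_approximation hk hn hε hεN hσ hL
      hδ0.le (contDiff_of_le hrc (by omega)) (fun i hi => hrb i (by omega))
    have hWSpd := hx.toIsMesh.piecewiseDiff hWSc.continuousOn
      (fun i hi => (hWSp i hi).imp fun _ h => h.2)
    have hWRpd := hx.toIsMesh.piecewiseDiff hWRc.continuousOn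
      (fun i hi => (hWRp i hi).imp fun _ h => h.2)
    have hA := (PiecewiseDiff.of_contDiff (meshSet (2 * (n + 1)) x)
      (hS2.of_le (by norm_num))).sub hWSpd
    have hR := (PiecewiseDiff.of_contDiff (meshSet (2 * (n + 1)) x)
      (contDiff_of_le (n := 1) hrc (by omega))).sub hWRpd
    -- At `0` neither approximant vanishes by itself, but their values add up to `S 0 + r 0 = U 0 =
    -- 0`.
    set χ : ℝ → ℝ := fun t => WS t + WR t - uN t with hχ
    have hχp : PiecewiseDiff (meshSet (2 * (n + 1)) x) χ := (hWSpd.add hWRpd).sub huNp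
    have hχ0 : χ 0 = 0 := by simp [hχ, hWS0, hWR0, hG.1.2.1, hr, hU0]
    have hχ1 : χ 1 = 0 := by simp [hχ, hWS1, hWR1, hG.1.2.2.1, hS1]
    have hχV : χ ∈ femSpace k (2 * (n + 1)) x := by
      refine ⟨hχp.continuousOn, hχ0, hχ1, fun i hi => ?_⟩
      obtain ⟨p₁, hp₁, hp₁e⟩ := hWSp i hi
      obtain ⟨p₂, hp₂, hp₂e⟩ := hWRp i hi
      obtain ⟨p₃, hp₃, hp₃e⟩ := hG.1.2.2.2 i hi
      refine ⟨p₁ + p₂ - p₃, ?_, fun t ht => ?_⟩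
      · exact (Polynomial.natDegree_sub_le _ _).trans
          (max_le ((Polynomial.natDegree_add_le _ _).trans (max_le hp₁ hp₂)) hp₃)
      · simp only [hχ, hp₁e t ht, hp₂e t ht, hp₃e t ht, Polynomial.eval_add, Polynomial.eval_sub]
    have horth : bilin ε b c (fun x => U x - uN x) χ = 0 := by
      rw [bilin_sub_left hs hb.continuous hc.continuous hUp huNp hχp, hG.2 χ hχV,
        bilin_eq_of_equation hs hb.continuous hc.continuous hU2 hUe hχp hχ0 hχ1, sub_self]
    have hfin := henergy ε ((Q₁ + Q₂) / N ^ k) (meshSet (2 * (n + 1)) x) _ _ _ χ hε hε1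
      (by positivity) hs hep hA hR hχp (fun t => by simp only [hr, hχ]; ring) hχ0 hχ1 horth ?_
    · refine hfin.trans ?_
      rw [← mul_div_assoc]
      refine div_le_div_of_nonneg_right ?_ (by positivity)
      linarith
    · intro t ht
      obtain ⟨a1, a2⟩ := hWSb t ht
      obtain ⟨a3, a4⟩ := hWRb t ht
      have e1 : (Q₁ + Q₂) / N ^ k = Q₁ / N ^ k + Q₂ / N ^ k := add_div _ _ _
      have e2 : 0 ≤ Q₁ / N ^ k := by positivity
      have e3 : 0 ≤ Q₂ / N ^ k := by positivity
      have e4 := mul_nonneg e2 (layerWeight_pos (β := δ) (ε := ε) (x := t) hε.le).le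
      rw [e1, add_mul]
      exact ⟨a1.trans (by linarith), a2.trans (by linarith), a3.trans (by linarith),
        a4.trans (by linarith)⟩
  -- Either `N = 2`, or `ε₀ < ε ≤ 1/N`. As `N` is bounded, the stability bound is `O(N^{-k})` with a
  -- suitable constant.
  · have hNle : N ≤ 4 + 1 / ε₀ := by
      have h0 : 0 < 1 / ε₀ := by positivity
      by_cases hn : 1 ≤ n
      · have hlt : ε₀ < ε := not_le.1 fun h => hcase ⟨hn, h⟩
        have h1 : N ≤ 1 / ε₀ := by
          rw [le_div_iff₀ hε₀]
          rw [le_div_iff₀ hN0] at hεN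
          nlinarith
        linarith
      · have : n = 0 := by omega
        have h2 : N = 2 := by rw [hNdef, this]; norm_num
        linarith
    have h1 := hstab ε (meshSet (2 * (n + 1)) x) U uN hε hs hUp huNp hU0 hU1 hG.1.2.1 hG.1.2.2.1
      (bilin_eq_of_equation hs hb.continuous hc.continuous hU2 hUe hUp hU0 hU1) (hG.2 uN hG.1)
    refine h1.trans ?_
    rw [le_div_iff₀ (by positivity)]
    have h2 := mul_le_mul_of_nonneg_left (pow_le_pow_left₀ hN0.le hNle k) hK₂
    have h3 : 0 ≤ K₁ * (Q₁ + Q₂) := by positivity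
    linarith

/-- The error estimate for data that are smooth on `[0,1]`. -/
theorem exists_error_bound {k : ℕ} (hk : 1 ≤ k) {b c f : ℝ → ℝ} {β γ σ H : ℝ}
    (hb : ContDiffOn ℝ (2 * k + 3 : ℕ) b (Icc 0 1)) (hc : ContDiffOn ℝ (2 * k + 3 : ℕ) c (Icc 0 1))
    (hf : ContDiffOn ℝ (2 * k + 3 : ℕ) f (Icc 0 1)) (hβ : 1 < β)
    (hbβ : ∀ x ∈ Icc (0 : ℝ) 1, β ≤ b x) (hγ : 0 < γ)
    (hcb : ∀ x ∈ Icc (0 : ℝ) 1, γ ≤ c x + 1 / 2 * derivWithin b (Icc 0 1) x)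
    (hσ : (k : ℝ) ≤ σ) (hH : 0 ≤ H) :
    ∃ C : ℝ, 0 < C ∧ ∀ (ε : ℝ) (n : ℕ) (x : ℕ → ℝ), 0 < ε → ε ≤ 1 / (2 * (n + 1) : ℕ) →
      IsBakhvalovMesh σ ε H n x → ∀ u uN : ℝ → ℝ, IsSolution ε b c f u →
      IsGalerkinSolution ε b c f k (2 * (n + 1)) x uN →
      FiniteEnergy (fun x => u x - uN x) ∧
      energyNorm ε (fun x => u x - uN x) ≤ C / ((2 * (n + 1) : ℕ) : ℝ) ^ k := by
  obtain ⟨b', hb', hbe⟩ := exists_contDiff_extension _ b hb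
  obtain ⟨c', hc', hce⟩ := exists_contDiff_extension _ c hc
  obtain ⟨f', hf', hfe⟩ := exists_contDiff_extension _ f hf
  have hb0 : ∀ x ∈ Icc (0 : ℝ) 1, b x ≠ 0 := fun x hx => by linarith [hbβ x hx]
  -- `1/b` is extended on its own, since the extension of `b` may vanish outside `[0,1]`.
  obtain ⟨p, hp, hpe⟩ := exists_contDiff_extension _ (fun x => (b x)⁻¹) (hb.inv hb0)
  obtain ⟨C, hC, hmain⟩ := exists_error_bound_of_contDiff (β := β) (γ := γ) (σ := σ) (H := H) hk
    hb' hc' hf' hp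
    (fun x hx => by rw [hbe hx, hpe hx]; exact mul_inv_cancel₀ (hb0 x hx)) hβ
    (fun x hx => by rw [hbe hx]; exact hbβ x hx) hγ
    (fun x hx => by
      have h1 : derivWithin b (Icc 0 1) x = deriv b' x := by
        rw [← derivWithin_congr hbe (hbe hx)]
        exact (hb'.differentiable (by simp) x).derivWithin
          (uniqueDiffOn_Icc zero_lt_one x hx)
      rw [hce hx, ← h1]
      exact hcb x hx) hσ hH
  refine ⟨C, hC, fun ε n x hε hεN hx u uN hu hG => ?_⟩
  have hu' : IsSolution ε b' c' f' u := by
    refine ⟨hu.continuousOn, hu.contDiffOn, fun t ht => ?_, hu.left_zero, hu.right_zero⟩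
    have ht' := Ioo_subset_Icc_self ht
    rw [hbe ht', hce ht', hfe ht']
    exact hu.equation t ht
  have hG' : IsGalerkinSolution ε b' c' f' k (2 * (n + 1)) x uN := by
    refine ⟨hG.1, fun v hv => ?_⟩
    rw [bilin_congr hbe hce, hG.2 v hv]
    refine intervalIntegral.integral_congr fun t ht => ?_
    rw [uIcc_of_le zero_le_one] at ht
    rw [hfe ht]
  obtain ⟨U, hU, hUu⟩ := hu'.exists_contDiff (m := k + 2) hε (contDiff_of_le hb' (by omega))
    (contDiff_of_le hc' (by omega)) (contDiff_of_le hf' (by omega))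
  have hUe := equation_of_eqOn hu' hb'.continuous hc'.continuous hf'.continuous
    (contDiff_of_le (n := 2) hU (by omega)) hUu
  obtain ⟨h1, h2⟩ := hmain ε n x hε hεN hx U uN hU hUe
    (by rw [hUu (by simp), hu.left_zero]) (by rw [hUu (by simp), hu.right_zero]) hG'
  have heq : EqOn (fun x => U x - uN x) (fun x => u x - uN x) (Icc 0 1) := fun t ht => by
    beta_reduce
    rw [hUu ht]
  exact ⟨h1.congr heq, energyNorm_congr heq ▸ h2⟩

end BakhvalovFEM

namespace BakhvalovFEM

/-! ### Roos' and Kopteva's meshes -/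

lemma log_sub_log_le {a b : ℝ} (ha : 0 < a) (hb : 0 < b) :
    Real.log b - Real.log a ≤ (b - a) / a := by
  rw [← Real.log_div hb.ne' ha.ne']
  refine (Real.log_le_sub_one_of_pos (by positivity)).trans (le_of_eq ?_)
  field_simp

/-- Width of a logarithmically graded mesh interval away from the transition point. -/
lemma log_width_le {σ ε q : ℝ} {n i : ℕ} (hσ : 0 < σ) (hε : 0 < ε)
    (hεN : ε ≤ 1 / (2 * (n + 1) : ℕ)) (hq2 : q ≤ 2) (hi : i < n) :
    -σ * ε * Real.log (1 - q * (((i + 1 : ℕ) : ℝ) / (2 * (n + 1) : ℕ)))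
      - -σ * ε * Real.log (1 - q * ((i : ℝ) / (2 * (n + 1) : ℕ))) ≤ σ / (2 * (n + 1) : ℕ) := by
  have h1 := two_div_le_grading (n := n) hq2 (i := i + 1) (by omega)
  have h0 := two_div_le_grading (n := n) hq2 (i := i) (by omega)
  have hN : (0 : ℝ) < ((2 * (n + 1) : ℕ) : ℝ) := by positivity
  set N : ℝ := ((2 * (n + 1) : ℕ) : ℝ) with hNdef
  have h2N : 0 < 2 / N := by positivity
  have h2 := log_sub_log_le (h2N.trans_le h1) (h2N.trans_le h0)
  have h3 : (1 - q * ((i : ℝ) / N) - (1 - q * (((i + 1 : ℕ) : ℝ) / N)))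
      / (1 - q * (((i + 1 : ℕ) : ℝ) / N)) ≤ 1 := by
    rw [div_le_one (h2N.trans_le h1)]
    have e1 : 1 - q * ((i : ℝ) / N) - (1 - q * (((i + 1 : ℕ) : ℝ) / N)) = q / N := by
      push_cast
      ring
    have e2 : q / N ≤ 2 / N := by gcongr
    linarith
  have h4 := mul_le_mul_of_nonneg_left (h2.trans h3) (show 0 ≤ σ * ε by positivity)
  have h5 : σ * ε ≤ σ / N := by
    have := mul_le_mul_of_nonneg_left hεN hσ.le
    rwa [mul_one_div] at this
  linarith

lemma log_grading_lt {σ ε q : ℝ} {N : ℝ} (hσ : 0 < σ) (hε : 0 < ε) (hN : 0 < N) (hq : 0 < q) {i : ℕ}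
    (h1 : 0 < 1 - q * (((i + 1 : ℕ) : ℝ) / N)) :
    -σ * ε * Real.log (1 - q * ((i : ℝ) / N))
      < -σ * ε * Real.log (1 - q * (((i + 1 : ℕ) : ℝ) / N)) := by
  have h2 : 1 - q * (((i + 1 : ℕ) : ℝ) / N) < 1 - q * ((i : ℝ) / N) := by
    have : 0 < q / N := by positivity
    have e1 : 1 - q * ((i : ℝ) / N) - (1 - q * (((i + 1 : ℕ) : ℝ) / N)) = q / N := by
      push_cast
      ring
    linarith
  have h3 := Real.log_lt_log h1 h2
  have h4 := mul_lt_mul_of_pos_left h3 (show 0 < σ * ε by positivity)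
  linarith

lemma isBakhvalovMesh_roos {σ ε : ℝ} {n : ℕ} (hσ : 0 < σ) (hε : 0 < ε)
    (hεN : ε ≤ 1 / (2 * (n + 1) : ℕ)) (hd : 0 < roosSlope σ ε) :
    IsBakhvalovMesh σ ε (2 * σ + 2) n (meshPoint (roosMap σ ε) (2 * (n + 1))) := by
  have hN : (0 : ℝ) < ((2 * (n + 1) : ℕ) : ℝ) := by positivity
  have hN2 : (2 : ℝ) ≤ ((2 * (n + 1) : ℕ) : ℝ) := by exact_mod_cast (by omega)
  have hhalf : (((n + 1 : ℕ) : ℝ) / (2 * (n + 1) : ℕ)) = 1 / 2 := by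
    push_cast
    field_simp
  have hnN : (n : ℝ) / (2 * (n + 1) : ℕ) = 1 / 2 - 1 / (2 * (n + 1) : ℕ) := by
    rw [← hhalf]
    push_cast
    ring
  have hwidth : ∀ i : ℕ, i < n → _ := fun i hi => log_width_le (q := 2 * (1 - ε)) hσ hε hεN
    (by linarith) hi
  have hlast : (((2 * (n + 1) : ℕ) : ℝ) / (2 * (n + 1) : ℕ)) = 1 := div_self hN.ne'
  have hcoarse : ∀ i : ℕ, n + 1 ≤ i → (1 : ℝ) / 2 ≤ (i : ℝ) / (2 * (n + 1) : ℕ) := fun i hi => by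
    rw [← hhalf]
    gcongr
  have hfineI : ∀ i : ℕ, i ≤ n + 1 → (i : ℝ) / (2 * (n + 1) : ℕ) ≤ 1 / 2 := fun i hi => by
    rw [← hhalf]
    gcongr
  have hgrad : ∀ i ≤ n, 2 / ((2 * (n + 1) : ℕ) : ℝ) ≤ _ := fun i hi =>
    two_div_le_grading (n := n) (q := 2 * (1 - ε)) (by linarith) hi
  set N : ℝ := ((2 * (n + 1) : ℕ) : ℝ) with hNdef
  have hN1 : 1 / N ≤ 1 / 2 := by gcongr
  have hε2 : ε ≤ 1 / 2 := hεN.trans hN1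
  have hσε : 0 < σ * ε := by positivity
  have hfine : ∀ i : ℕ, i ≤ n + 1 → meshPoint (roosMap σ ε) (2 * (n + 1)) i =
      -σ * ε * Real.log (1 - 2 * (1 - ε) * ((i : ℝ) / N)) := fun i hi => by
    rw [meshPoint, roosMap, if_pos (hfineI i hi), roosFine]
  have hd2 : roosSlope σ ε = 2 * (1 - roosFine σ ε (1 / 2)) := by
    rw [roosSlope, coarseSlope]
    ring
  have hy : 0 ≤ roosFine σ ε (1 / 2) := by
    have e1 : 1 - 2 * (1 - ε) * (1 / 2) = ε := by ring
    rw [roosFine, e1]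
    have := mul_nonpos_of_nonneg_of_nonpos hσε.le (Real.log_nonpos hε.le (by linarith))
    linarith
  have hcoarseE : ∀ i : ℕ, n + 1 ≤ i → meshPoint (roosMap σ ε) (2 * (n + 1)) i =
      1 - roosSlope σ ε * (1 - (i : ℝ) / N) := fun i hi => by
    rw [meshPoint, roosMap]
    rcases eq_or_lt_of_le (hcoarse i hi) with h | h
    -- At `i = n + 1` the argument is exactly `1/2` and falls to the logarithmic branch. Continuity
    -- there gives the coarse formula as well.
    · rw [if_pos h.symm.le, ← h, hd2]
      ring
    · rw [if_neg (not_le.2 h)]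
  have hX : 0 < 1 - 2 * (1 - ε) * (((n + 1 : ℕ) : ℝ) / N) := by
    rw [hhalf]
    linarith
  have h2N : 0 < 2 / N := by positivity
  have hcw : ∀ i : ℕ, n + 1 ≤ i → meshPoint (roosMap σ ε) (2 * (n + 1)) (i + 1)
      - meshPoint (roosMap σ ε) (2 * (n + 1)) i = roosSlope σ ε / N := fun i hi => by
    rw [hcoarseE i hi, hcoarseE (i + 1) (by omega)]
    push_cast
    ring
  refine { zero := ?_, last := ?_, lt := ?_, width := ?_, graded := ?_ }
  · rw [hfine 0 (by omega)]
    simp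
  · rw [hcoarseE _ (by omega), hlast]
    ring
  · intro i hi
    rcases Nat.lt_or_ge i (n + 1) with h | h
    · rw [hfine i (by omega), hfine (i + 1) (by omega)]
      refine log_grading_lt hσ hε hN (by linarith) ?_
      rcases Nat.lt_or_ge i n with h' | h'
      · exact h2N.trans_le (hgrad (i + 1) (by omega))
      · obtain rfl : i = n := by omega
        exact hX
    · have := hcw i h
      have : 0 < roosSlope σ ε / N := by positivity
      linarith
  · intro i hi
    rcases Nat.lt_trichotomy i n with h | h | h
    · rw [hfine i (by omega), hfine (i + 1) (by omega)]
      refine (hwidth i h).trans ?_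
      gcongr
      linarith
    -- Transition interval: the argument of the logarithm drops to exactly `ε`, so the prefactor `σ
    -- ε` cancels and the width is at most `2σ(1-ε)/N`.
    · rw [h, hfine n (by omega), hfine (n + 1) le_rfl]
      have h1 := log_sub_log_le hX (h2N.trans_le (hgrad n le_rfl))
      have e1 : 1 - 2 * (1 - ε) * ((n : ℝ) / N) - (1 - 2 * (1 - ε) * (((n + 1 : ℕ) : ℝ) / N))
          = 2 * (1 - ε) / N := by
        push_cast
        ring
      have e2 : 1 - 2 * (1 - ε) * (((n + 1 : ℕ) : ℝ) / N) = ε := by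
        rw [hhalf]
        ring
      rw [e1] at h1
      rw [e2] at h1 ⊢
      have h2 := mul_le_mul_of_nonneg_left h1 hσε.le
      have e3 : σ * ε * (2 * (1 - ε) / N / ε) = σ * (2 * (1 - ε)) / N := by field_simp
      have e4 : σ * (2 * (1 - ε)) / N ≤ (2 * σ + 2) / N := by
        gcongr
        nlinarith
      linarith
    · rw [hcw i h]
      gcongr
      linarith
  · refine ⟨2 * (1 - ε), by linarith, by linarith, ?_, fun i hi => hfine i (by omega)⟩
    rw [hnN]
    have e1 : 1 - 2 * (1 - ε) * (1 / 2 - 1 / N) = ε + 2 * (1 / N) - 2 * ε * (1 / N) := by ring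
    have e2 : 0 ≤ 2 * ε * (1 / N) := by positivity
    have e3 : 3 / N = 3 * (1 / N) := by ring
    rw [e1, e3]
    linarith

lemma isBakhvalovMesh_kopteva {σ C₁ ε : ℝ} {n : ℕ} (hσ : 0 < σ) (hC₁ : 0 < C₁) (hε : 0 < ε)
    (hεN : ε ≤ 1 / (2 * (n + 1) : ℕ)) (hCN : C₁ ≤ 1 / (ε * (2 * (n + 1) : ℕ)))
    (hd : 0 < koptevaSlope σ C₁ ε) :
    IsBakhvalovMesh σ ε (σ + σ / C₁ + 2) n (meshPoint (koptevaMap σ C₁ ε) (2 * (n + 1))) := by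
  have hN : (0 : ℝ) < ((2 * (n + 1) : ℕ) : ℝ) := by positivity
  have hN2 : (2 : ℝ) ≤ ((2 * (n + 1) : ℕ) : ℝ) := by exact_mod_cast (by omega)
  have hhalf : (((n + 1 : ℕ) : ℝ) / (2 * (n + 1) : ℕ)) = 1 / 2 := by
    push_cast
    field_simp
  have hnN : (n : ℝ) / (2 * (n + 1) : ℕ) = 1 / 2 - 1 / (2 * (n + 1) : ℕ) := by
    rw [← hhalf]
    push_cast
    ring
  have hwidth : ∀ i : ℕ, i < n → _ := fun i hi => log_width_le (q := 2) hσ hε hεN le_rfl hi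
  have hlast : (((2 * (n + 1) : ℕ) : ℝ) / (2 * (n + 1) : ℕ)) = 1 := div_self hN.ne'
  have hcoarse : ∀ i : ℕ, n + 1 ≤ i → (1 : ℝ) / 2 ≤ (i : ℝ) / (2 * (n + 1) : ℕ) := fun i hi => by
    rw [← hhalf]
    gcongr
  have hfineI : ∀ i : ℕ, i ≤ n → (i : ℝ) / (2 * (n + 1) : ℕ) ≤ 1 / 2 - 1 / (2 * (n + 1) : ℕ) :=
    fun i hi => by
      rw [← hnN]
      gcongr
  have hgrad : ∀ i ≤ n, 2 / ((2 * (n + 1) : ℕ) : ℝ) ≤ _ := fun i hi =>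
    two_div_le_grading (n := n) (q := 2) le_rfl hi
  set N : ℝ := ((2 * (n + 1) : ℕ) : ℝ) with hNdef
  have hN1 : 1 / N ≤ 1 / 2 := by gcongr
  have hσε : 0 < σ * ε := by positivity
  have hCε0 : 0 < C₁ * ε := by positivity
  -- Hence the breakpoint lies between `n/N`, inclusive, and `(n+1)/N`, exclusive: node `n` is on
  -- the fine branch and node `n + 1` on the coarse one.
  have hCε : C₁ * ε ≤ 1 / N := by
    rw [le_div_iff₀ (by positivity)] at hCN ⊢
    linarith
  have hfine : ∀ i : ℕ, i ≤ n → meshPoint (koptevaMap σ C₁ ε) (2 * (n + 1)) i =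
      -σ * ε * Real.log (1 - 2 * ((i : ℝ) / N)) := fun i hi => by
    rw [meshPoint, koptevaMap, if_pos, koptevaFine]
    rw [koptevaBreak]
    linarith [hfineI i hi]
  have hcoarseE : ∀ i : ℕ, n + 1 ≤ i → meshPoint (koptevaMap σ C₁ ε) (2 * (n + 1)) i =
      1 - koptevaSlope σ C₁ ε * (1 - (i : ℝ) / N) := fun i hi => by
    rw [meshPoint, koptevaMap, if_neg]
    rw [koptevaBreak, not_le]
    linarith [hcoarse i hi]
  set y := koptevaFine σ ε (koptevaBreak C₁ ε) with hy
  have hyl : y = -σ * ε * Real.log (2 * (C₁ * ε)) := by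
    rw [hy, koptevaFine, koptevaBreak]
    congr 2
    ring
  have hy0 : 0 ≤ y := by
    have := mul_nonpos_of_nonneg_of_nonpos hσε.le
      (Real.log_nonpos (show 0 ≤ 2 * (C₁ * ε) by positivity) (by linarith))
    rw [hyl]
    linarith
  have hslope : koptevaSlope σ C₁ ε * (1 / 2 + C₁ * ε) = 1 - y := by
    have e1 : 1 - koptevaBreak C₁ ε = 1 / 2 + C₁ * ε := by
      rw [koptevaBreak]
      ring
    rw [koptevaSlope, coarseSlope, e1, div_mul_cancel₀ _ (by positivity)]
  have hd2 : koptevaSlope σ C₁ ε ≤ 2 := by nlinarith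
  have hcw : ∀ i : ℕ, n + 1 ≤ i → meshPoint (koptevaMap σ C₁ ε) (2 * (n + 1)) (i + 1)
      - meshPoint (koptevaMap σ C₁ ε) (2 * (n + 1)) i = koptevaSlope σ C₁ ε / N := fun i hi => by
    rw [hcoarseE i hi, hcoarseE (i + 1) (by omega)]
    push_cast
    ring
  have htrans : meshPoint (koptevaMap σ C₁ ε) (2 * (n + 1)) (n + 1)
      = y + koptevaSlope σ C₁ ε * (C₁ * ε) := by
    rw [hcoarseE _ le_rfl, hhalf]
    linarith
  have hXn : 1 - 2 * ((n : ℝ) / N) = 2 * (1 / N) := by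
    rw [hnN]
    ring
  have h2N : 0 < 2 / N := by positivity
  refine { zero := ?_, last := ?_, lt := ?_, width := ?_, graded := ?_ }
  · rw [hfine 0 (by omega)]
    simp
  · rw [hcoarseE _ (by omega), hlast]
    ring
  · intro i hi
    rcases Nat.lt_trichotomy i n with h | h | h
    · rw [hfine i (by omega), hfine (i + 1) (by omega)]
      exact log_grading_lt hσ hε hN (by norm_num) (h2N.trans_le (hgrad (i + 1) (by omega)))
    · rw [h, htrans, hfine n le_rfl, hXn, hyl]
      have h1 := Real.log_le_log (show 0 < 2 * (C₁ * ε) by positivity)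
        (show 2 * (C₁ * ε) ≤ 2 * (1 / N) by linarith)
      have h2 := mul_le_mul_of_nonneg_left h1 hσε.le
      have h3 : 0 < koptevaSlope σ C₁ ε * (C₁ * ε) := by positivity
      linarith
    · have := hcw i h
      have : 0 < koptevaSlope σ C₁ ε / N := by positivity
      linarith
  · intro i hi
    have hσC : 0 < σ / C₁ := by positivity
    rcases Nat.lt_trichotomy i n with h | h | h
    · rw [hfine i (by omega), hfine (i + 1) (by omega)]
      refine (hwidth i h).trans ?_
      gcongr
      linarith
    -- The breakpoint splits the transition interval. The logarithmic piece contributes at most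
    -- `σ/(C₁ N)`, the linear piece `d₁ C₁ ε ≤ 2/N`.
    · rw [h, htrans, hfine n le_rfl, hXn, hyl]
      have h1 := log_sub_log_le (show 0 < 2 * (C₁ * ε) by positivity)
        (show 0 < 2 * (1 / N) by positivity)
      have h2 : (2 * (1 / N) - 2 * (C₁ * ε)) / (2 * (C₁ * ε)) ≤ 2 * (1 / N) / (2 * (C₁ * ε)) := by
        gcongr
        linarith
      have h3 := mul_le_mul_of_nonneg_left (h1.trans h2) hσε.le
      have e1 : σ * ε * (2 * (1 / N) / (2 * (C₁ * ε))) = σ / C₁ / N := by field_simp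
      have h4 : koptevaSlope σ C₁ ε * (C₁ * ε) ≤ 2 * (1 / N) :=
        mul_le_mul hd2 hCε hCε0.le (by norm_num)
      have e2 : (σ + σ / C₁ + 2) / N = σ / N + σ / C₁ / N + 2 * (1 / N) := by ring
      have h5 : 0 < σ / N := by positivity
      linarith
    · rw [hcw i h]
      gcongr
      linarith
  · refine ⟨2, by norm_num, le_rfl, ?_, fun i hi => hfine i hi⟩
    rw [hXn, mul_one_div]
    gcongr
    norm_num

end BakhvalovFEM

end

/-! ### The estimate for both meshes -/

theorem theorem1 (k : ℕ) (hk : 1 ≤ k) :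
    -- the order of smoothness of the data that suffices depends only on `k`
    ∃ m : ℕ, ∀ (b c f : ℝ → ℝ) (β γ σ : ℝ),
      ContDiffOn ℝ m b (Icc 0 1) → ContDiffOn ℝ m c (Icc 0 1) → ContDiffOn ℝ m f (Icc 0 1) →
      1 < β → (∀ x ∈ Icc (0 : ℝ) 1, β ≤ b x) →
      0 < γ → (∀ x ∈ Icc (0 : ℝ) 1, γ ≤ c x + 1 / 2 * derivWithin b (Icc 0 1) x) →
      (k : ℝ) + 1 ≤ σ →
      -- Roos' mesh
      (∃ C : ℝ, 0 < C ∧ ∀ (ε : ℝ) (N : ℕ), 0 < ε → 0 < N → Even N → ε ≤ 1 / (N : ℝ) →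
        0 < BakhvalovFEM.roosSlope σ ε →
        ∀ u uN : ℝ → ℝ, BakhvalovFEM.IsSolution ε b c f u →
          BakhvalovFEM.IsGalerkinSolution ε b c f k N
            (BakhvalovFEM.meshPoint (BakhvalovFEM.roosMap σ ε) N) uN →
          BakhvalovFEM.FiniteEnergy (fun x => u x - uN x) ∧
          BakhvalovFEM.energyNorm ε (fun x => u x - uN x) ≤ C / (N : ℝ) ^ k) ∧
      -- Kopteva's mesh
      (∀ C₁ : ℝ, 0 < C₁ →
        ∃ C : ℝ, 0 < C ∧ ∀ (ε : ℝ) (N : ℕ), 0 < ε → 0 < N → Even N → ε ≤ 1 / (N : ℝ) →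
          C₁ ≤ 1 / (ε * (N : ℝ)) → 0 < BakhvalovFEM.koptevaSlope σ C₁ ε →
          ∀ u uN : ℝ → ℝ, BakhvalovFEM.IsSolution ε b c f u →
            BakhvalovFEM.IsGalerkinSolution ε b c f k N
              (BakhvalovFEM.meshPoint (BakhvalovFEM.koptevaMap σ C₁ ε) N) uN →
            BakhvalovFEM.FiniteEnergy (fun x => u x - uN x) ∧
            BakhvalovFEM.energyNorm ε (fun x => u x - uN x) ≤ C / (N : ℝ) ^ k) := by
  refine ⟨2 * k + 3, ?_⟩
  intro b c f β γ σ hb hc hf hβ hbβ hγ hcb hσ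
  have hσk : (k : ℝ) ≤ σ := by linarith
  have hσ0 : 0 < σ := by linarith [Nat.cast_nonneg (α := ℝ) k]
  refine ⟨?_, fun C₁ hC₁ => ?_⟩
  · obtain ⟨C, hC, h⟩ := BakhvalovFEM.exists_error_bound (H := 2 * σ + 2) hk hb hc hf hβ hbβ hγ hcb
      hσk (by positivity)
    refine ⟨C, hC, fun ε N hε hN hNe hεN hd u uN hu huN => ?_⟩
    obtain ⟨n, rfl⟩ : ∃ n, N = 2 * (n + 1) := by
      obtain ⟨l, hl⟩ := hNe
      exact ⟨l - 1, by omega⟩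
    exact h ε n _ hε hεN (BakhvalovFEM.isBakhvalovMesh_roos hσ0 hε hεN hd) u uN hu huN
  · obtain ⟨C, hC, h⟩ := BakhvalovFEM.exists_error_bound (H := σ + σ / C₁ + 2) hk hb hc hf hβ hbβ hγ
      hcb hσk (by positivity)
    refine ⟨C, hC, fun ε N hε hN hNe hεN hCN hd u uN hu huN => ?_⟩
    obtain ⟨n, rfl⟩ : ∃ n, N = 2 * (n + 1) := by
      obtain ⟨l, hl⟩ := hNe
      exact ⟨l - 1, by omega⟩
    exact h ε n _ hε hεN (BakhvalovFEM.isBakhvalovMesh_kopteva hσ0 hC₁ hε hεN hCN hd) u uN hu huN
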